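/- **Theorem.** Let $\mathbb H^d$ be the space of quaternionic column vectors with its Euclidean metric and flat hyperkähler structure, and let $Sp(d)=\{A\in \mathrm{Mat}_d(\mathbb H): A^\dagger A=AA^\dagger=1\}$ ($\dagger$ is the quaternionic conjugate transpose) act on it by left multiplication. Let $G$ be a closed subgroup of $Sp(d)$ with Lie algebra $\mathfrak g=\{A\in \mathrm{Mat}_d(\mathbb H) : \exp(tA)\in G \text{ for all } t\in\mathbb R\}$, and let $\mu=(\mu_1,\mu_2,\mu_3):\mathbb H^d\to\mathfrak g\otimes\mathbb R^3$ be the hyperkähler moment map whose components are the orthogonal projections, with respect to $\langle A,B\rangle=\mathrm{Re}\,\mathrm{tr}(AB^\dagger)$, of $$q\,i\,q^\dagger,\qquad q\,j\,q^\dagger,\qquad q\,k\,q^\dagger$$ onto $\mathfrak g$. Suppose that $G$ acts locally freely on $\mu^{-1}(0)\setminus\{0\}$, i.e. the stabilizer of every point of this set is discrete. Let $c=(c_1,c_2,c_3)$, where each $c_l$ is a central element of $\mathfrak g$, and suppose that $G$ acts freely on $\mu^{-1}(c)$ (that is, $G$ preserves $\mu^{-1}(c)$ and all stabilizers of its points are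 trivial). Then the hyperkähler quotient $Q=\mu^{-1}(c)/G$ (with the quotient topology) is covered by smooth charts of dimension $n=4d-4\dim G$: every point of $Q$ lies in the image of a chart given by a smooth local slice $s:U\to\mu^{-1}(c)$, where $U\subseteq\mathbb R^{n}$ is open, $s$ is transverse to the $G$-orbits, and $s$ induces a homeomorphism of $U$ onto an open subset of $Q$. Let $Q$ carry the quotient metric, for which $\mu^{-1}(c)\to Q$ is a Riemannian submersion, $\mu^{-1}(c)$ having the metric induced from $\mathbb H^d$; in a chart $s$ it is $g_{ab}=\langle(\partial_a s)^h,(\partial_b s)^h\rangle$, where $h$ denotes the component orthogonal to the orbit. Then the curvature of $Q$ is asymptotically null: for every $\varepsilon>0$ there is a compact set $C\subseteq Q$ such that the sectional curvatures of $Q$ satisfy $|K_Q(p)(\pi)|<\varepsilon$ for every $p\in Q\setminus C$ and every plane $\pi\subset T_pQ$. -/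

import Mathlib

open scoped Quaternion Matrix Topology ContDiff
open Filter

noncomputable section

namespace HKQuot

/-! ## The Lie product formula (needed for the Lie algebra of a closed matrix group) -/

section LieProduct

variable {𝔸 : Type*} [NormedRing 𝔸] [NormedAlgebra ℝ 𝔸] [CompleteSpace 𝔸]

theorem tendsto_pow_exp_of_hasDerivAt {γ : ℝ → 𝔸} {X : 𝔸} (h0 : γ 0 = 1)
    (hγ : HasDerivAt γ X 0) :
    Tendsto (fun n : ℕ => γ ((n : ℝ)⁻¹) ^ n) atTop (𝓝 (NormedSpace.exp X)) := by
  let _ : NormedAlgebra ℚ 𝔸 := NormedAlgebra.restrictScalars ℚ ℝ 𝔸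
  have hexp : HasStrictFDerivAt (NormedSpace.exp : 𝔸 → 𝔸)
      ((ContinuousLinearEquiv.refl ℝ 𝔸 : 𝔸 ≃L[ℝ] 𝔸) : 𝔸 →L[ℝ] 𝔸) 0 :=
    hasStrictFDerivAt_exp_zero
  set L := hexp.localInverse with hL
  have hL1 : HasStrictFDerivAt L
      (((ContinuousLinearEquiv.refl ℝ 𝔸).symm : 𝔸 ≃L[ℝ] 𝔸) : 𝔸 →L[ℝ] 𝔸) 1 := by
    have := hexp.to_localInverse
    rwa [NormedSpace.exp_zero] at this
  have hLone : L 1 = 0 := by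
    have := hexp.localInverse_apply_image
    rwa [NormedSpace.exp_zero] at this
  have hcomp : HasDerivAt (fun s => L (γ s)) X 0 := by
    have h1 : HasFDerivAt L
      (((ContinuousLinearEquiv.refl ℝ 𝔸).symm : 𝔸 ≃L[ℝ] 𝔸) : 𝔸 →L[ℝ] 𝔸) (γ 0) := by
      rw [h0]; exact hL1.hasFDerivAt
    have h2 := h1.comp_hasDerivAt 0 hγ
    simp only [ContinuousLinearEquiv.coe_coe, ContinuousLinearEquiv.refl_symm,
      ContinuousLinearEquiv.coe_refl', id_eq] at h2
    exact h2
  have hinv0 : Tendsto (fun n : ℕ => ((n : ℝ)⁻¹)) atTop (𝓝 0) :=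
    tendsto_inv_atTop_zero.comp tendsto_natCast_atTop_atTop
  have hinv : Tendsto (fun n : ℕ => ((n : ℝ)⁻¹)) atTop (𝓝[≠] 0) := by
    refine tendsto_nhdsWithin_iff.2 ⟨hinv0, ?_⟩
    filter_upwards [eventually_gt_atTop 0] with n hn
    simpa using hn.ne'
  have hslope : Tendsto (fun n : ℕ => (n : ℕ) • L (γ ((n : ℝ)⁻¹))) atTop (𝓝 X) := by
    have := (hasDerivAt_iff_tendsto_slope.1 hcomp).comp hinv
    refine this.congr fun n => ?_
    simp [slope, h0, hLone, Nat.cast_smul_eq_nsmul]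
  have hlim : Tendsto (fun n : ℕ => NormedSpace.exp ((n : ℕ) • L (γ ((n : ℝ)⁻¹)))) atTop
      (𝓝 (NormedSpace.exp X)) :=
    (NormedSpace.exp_continuous.tendsto X).comp hslope
  refine hlim.congr' ?_
  have hγc : Tendsto (fun n : ℕ => γ ((n : ℝ)⁻¹)) atTop (𝓝 1) := by
    have := hγ.continuousAt.tendsto.comp hinv0
    rwa [h0] at this
  have hev : ∀ᶠ y in 𝓝 (1 : 𝔸), NormedSpace.exp (L y) = y := by
    have := hexp.eventually_right_inverse
    rwa [NormedSpace.exp_zero] at this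
  filter_upwards [hγc.eventually hev] with n hn
  rw [NormedSpace.exp_nsmul, hn]

theorem lie_product_formula (X Y : 𝔸) :
    Tendsto (fun n : ℕ => (NormedSpace.exp ((n : ℝ)⁻¹ • X) * NormedSpace.exp ((n : ℝ)⁻¹ • Y)) ^ n)
      atTop (𝓝 (NormedSpace.exp (X + Y))) := by
  refine tendsto_pow_exp_of_hasDerivAt
    (γ := fun s : ℝ => NormedSpace.exp (s • X) * NormedSpace.exp (s • Y)) (by simp) ?_
  have := (hasDerivAt_exp_smul_const (𝕂 := ℝ) X (0 : ℝ)).mul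
    (hasDerivAt_exp_smul_const (𝕂 := ℝ) Y (0 : ℝ))
  simp only [zero_smul, NormedSpace.exp_zero, one_mul, mul_one] at this
  exact this

end LieProduct

/-! ## The flat hyperkähler space `ℍ^d` and the group `Sp(d)` -/

/-- `ℍ^d` with its Euclidean inner product. -/
abbrev HSpace (d : ℕ) : Type := PiLp 2 (fun _ : Fin d => ℍ[ℝ])

/-- Quaternionic `d × d` matrices; `star` is the conjugate transpose `A†`. -/
abbrev HMat (d : ℕ) : Type := Matrix (Fin d) (Fin d) ℍ[ℝ]

/-- `Sp(d)`: quaternionic matrices with `A† A = A A† = 1`. -/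
abbrev Sp (d : ℕ) : Type := unitary (HMat d)

/-- Left multiplication of a column vector by a matrix. -/
def mulVec {d : ℕ} (A : HMat d) (q : HSpace d) : HSpace d := WithLp.toLp 2 (A *ᵥ q.ofLp)

/-- The standard linear action of `Sp(d)` on `ℍ^d`. -/
instance (d : ℕ) : MulAction (Sp d) (HSpace d) where
  smul A q := mulVec (A : HMat d) q
  one_smul q := by
    change mulVec (1 : HMat d) q = q
    simp [mulVec]
  mul_smul A B q := by
    change mulVec ((A : HMat d) * (B : HMat d)) q = mulVec (A : HMat d) (mulVec (B : HMat d) q)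
    simp [mulVec]

/-- The imaginary units `i, j, k`. -/
def imUnit : Fin 3 → ℍ[ℝ] := ![⟨0, 1, 0, 0⟩, ⟨0, 0, 1, 0⟩, ⟨0, 0, 0, 1⟩]

/-! ## The Lie algebra and the moment map of a closed subgroup -/

section Group

variable {d : ℕ}

/-- `A` generates a one-parameter subgroup of `G`. -/
def IsGenerator (G : Subgroup (Sp d)) (A : HMat d) : Prop :=
  ∀ t : ℝ, ∃ g ∈ G, ((g : Sp d) : HMat d) = NormedSpace.exp (t • A)

section

attribute [local instance] Matrix.linftyOpNormedRing Matrix.linftyOpNormedAlgebra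

theorem isClosed_coe_image (G : Subgroup (Sp d)) (hG : IsClosed (G : Set (Sp d))) :
    IsClosed ((Subtype.val : Sp d → HMat d) '' (G : Set (Sp d))) := by
  refine (IsClosed.isClosedEmbedding_subtypeVal ?_).isClosedMap _ hG
  have h1 : IsClosed {U : HMat d | star U * U = 1} :=
    isClosed_eq (continuous_star.mul continuous_id) continuous_const
  have h2 : IsClosed {U : HMat d | U * star U = 1} :=
    isClosed_eq (continuous_id.mul continuous_star) continuous_const
  exact h1.inter h2

theorem IsGenerator.add {G : Subgroup (Sp d)} (hG : IsClosed (G : Set (Sp d))) {A B : HMat d}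
    (hA : IsGenerator G A) (hB : IsGenerator G B) : IsGenerator G (A + B) := by
  intro t
  have hlim := lie_product_formula (t • A) (t • B)
  rw [← smul_add] at hlim
  have := (isClosed_coe_image G hG).mem_of_tendsto hlim (Eventually.of_forall fun n => by
    obtain ⟨a, ha, ha'⟩ := hA ((n : ℝ)⁻¹ * t)
    obtain ⟨b, hb, hb'⟩ := hB ((n : ℝ)⁻¹ * t)
    refine ⟨(a * b) ^ n, G.pow_mem (G.mul_mem ha hb) n, ?_⟩
    simp only [SubmonoidClass.coe_pow, Submonoid.coe_mul, ha', hb', smul_smul]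
    rfl)
  obtain ⟨g, hg, hg'⟩ := this
  exact ⟨g, hg, hg'⟩

end

/-- The Lie algebra `𝔤 = {A | exp (t A) ∈ G for all t}` of a closed subgroup `G` of `Sp(d)`, as a
real subspace of the quaternionic matrices. -/
def lieAlg (G : Subgroup (Sp d)) (hG : IsClosed (G : Set (Sp d))) : Submodule ℝ (HMat d) where
  carrier := {A | IsGenerator G A}
  add_mem' := fun hA hB => IsGenerator.add hG hA hB
  zero_mem' := fun t => ⟨1, G.one_mem, by simp⟩
  smul_mem' := fun s A hA t => by
    obtain ⟨g, hg, hg'⟩ := hA (t * s)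
    exact ⟨g, hg, by rw [hg', smul_smul]⟩

/-- Matrices as a Euclidean space, with inner product `⟪A, B⟫ = Re tr (A B†)`. -/
def matEuclid (d : ℕ) : HMat d ≃ₗ[ℝ] PiLp 2 (fun _ : Fin d × Fin d => ℍ[ℝ]) where
  toFun A := WithLp.toLp 2 fun p => A p.1 p.2
  invFun v := Matrix.of fun a b => v (a, b)
  map_add' _ _ := rfl
  map_smul' _ _ := rfl
  left_inv _ := rfl
  right_inv _ := rfl

/-- The matrices `q i q†`, `q j q†`, `q k q†` (for `l = 0, 1, 2`). -/
def spMoment (l : Fin 3) (q : HSpace d) : HMat d :=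
  Matrix.of fun a b => q a * imUnit l * star (q b)

variable (G : Subgroup (Sp d)) (hG : IsClosed (G : Set (Sp d)))

/-- The hyperkähler moment map `μ = (μ₁, μ₂, μ₃)` of `G`: the orthogonal projections of
`q i q†`, `q j q†`, `q k q†` onto `𝔤`. -/
def momentMap (l : Fin 3) (q : HSpace d) : HMat d :=
  (matEuclid d).symm
    (((lieAlg G hG).map (matEuclid d).toLinearMap).starProjection (matEuclid d (spMoment l q)))

/-- `A` lies in the centre of the Lie algebra `𝔤`. -/
def IsCentral (A : HMat d) : Prop :=
  A ∈ lieAlg G hG ∧ ∀ B ∈ lieAlg G hG, A * B = B * A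

/-- `μ⁻¹(c)`. -/
def levelSet (c : Fin 3 → HMat d) : Set (HSpace d) := {q | ∀ l, momentMap G hG l q = c l}

/-- `G` acts freely on the set `S`: it preserves `S` and all stabilizers are trivial. -/
def ActsFreelyOn (S : Set (HSpace d)) : Prop :=
  (∀ g ∈ G, ∀ q ∈ S, g • q ∈ S) ∧ ∀ q ∈ S, MulAction.stabilizer G q = ⊥

/-- `G` acts locally freely on the set `S`: the stabilizers of its points are discrete. (This is
used for `μ⁻¹(0) ∖ {0}`, which is automatically preserved by `G`.) -/
def ActsLocallyFreelyOn (S : Set (HSpace d)) : Prop :=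
  ∀ q ∈ S, DiscreteTopology (MulAction.stabilizer G q)

/-- The tangent space `{ρ q | ρ ∈ 𝔤}` of the orbit at `q`. -/
def orbitTangent (q : HSpace d) : Submodule ℝ (HSpace d) where
  carrier := {v | ∃ A ∈ lieAlg G hG, mulVec A q = v}
  add_mem' := by
    rintro _ _ ⟨A, hA, rfl⟩ ⟨B, hB, rfl⟩
    exact ⟨A + B, add_mem hA hB, by simp [mulVec, Matrix.add_mulVec]⟩
  zero_mem' := ⟨0, zero_mem _, by simp [mulVec]⟩
  smul_mem' := by
    rintro t _ ⟨A, hA, rfl⟩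
    exact ⟨t • A, (lieAlg G hG).smul_mem t hA, by simp [mulVec, Matrix.smul_mulVec]⟩

/-! ## The hyperkähler quotient -/

/-- Points of `μ⁻¹(c)` are equivalent if they lie in the same `G`-orbit. -/
def orbitSetoid (c : Fin 3 → HMat d) : Setoid (levelSet G hG c) :=
  (MulAction.orbitRel G (HSpace d)).comap Subtype.val

/-- The quotient `Q = μ⁻¹(c)/G`, with the quotient topology. -/
def QuotSpace (c : Fin 3 → HMat d) : Type := Quotient (orbitSetoid G hG c)

instance (c : Fin 3 → HMat d) : TopologicalSpace (QuotSpace G hG c) :=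
  inferInstanceAs (TopologicalSpace (Quotient (orbitSetoid G hG c)))

/-- The projection `μ⁻¹(c) → Q`. -/
def proj (c : Fin 3 → HMat d) (q : levelSet G hG c) : QuotSpace G hG c :=
  Quotient.mk (orbitSetoid G hG c) q

/-- `dim Q = 4 d - 4 dim G`. -/
def quotDim : ℕ := 4 * d - 4 * Module.finrank ℝ (lieAlg G hG)

/-- A smooth chart of the quotient manifold `Q`, written as a parametrization: a homeomorphism from
an open set `U ⊆ ℝⁿ`, `n = dim Q`, onto an open subset of `Q`, induced by a smooth map
`U → μ⁻¹(c)` that is transverse to the `G`-orbits (a local slice). -/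
structure Chart (c : Fin 3 → HMat d) where
  /-- the parameter domain `U` -/
  source : Set (EuclideanSpace ℝ (Fin (quotDim G hG)))
  isOpen_source : IsOpen source
  /-- the local slice -/
  slice : EuclideanSpace ℝ (Fin (quotDim G hG)) → HSpace d
  contDiffOn_slice : ContDiffOn ℝ ∞ slice source
  slice_mem : ∀ x ∈ source, slice x ∈ levelSet G hG c
  transverse : ∀ x ∈ source, ∀ u, fderiv ℝ slice x u ∈ orbitTangent G hG (slice x) → u = 0
  isOpenEmbedding :
    Topology.IsOpenEmbedding fun x : source => proj G hG c ⟨slice x, slice_mem x x.2⟩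

variable {G hG}

/-- The point of `Q` with parameter `x`. -/
def Chart.point {c : Fin 3 → HMat d} (φ : Chart G hG c) (x : φ.source) : QuotSpace G hG c :=
  proj G hG c ⟨φ.slice x, φ.slice_mem x x.2⟩

/-- The matrix `(g_ab)` in the chart `φ` of the quotient metric, for which the projection
`μ⁻¹(c) → Q` is a Riemannian submersion: the inner product of the components of `∂_a φ` and `∂_b φ`
orthogonal to the orbit. -/
def Chart.metric {c : Fin 3 → HMat d} (φ : Chart G hG c)
    (x : EuclideanSpace ℝ (Fin (quotDim G hG))) :
    Matrix (Fin (quotDim G hG)) (Fin (quotDim G hG)) ℝ :=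
  Matrix.of fun a b =>
    inner ℝ
      ((orbitTangent G hG (φ.slice x))ᗮ.starProjection
        (fderiv ℝ φ.slice x (EuclideanSpace.single a 1)))
      ((orbitTangent G hG (φ.slice x))ᗮ.starProjection
        (fderiv ℝ φ.slice x (EuclideanSpace.single b 1)))

end Group

/-! ## Sectional curvature of a Riemannian metric in coordinates -/

section Curvature

variable {n : ℕ}

/-- The partial derivative `∂_i f`. -/
def pderiv (i : Fin n) (f : EuclideanSpace ℝ (Fin n) → ℝ) (x : EuclideanSpace ℝ (Fin n)) : ℝ :=
  fderiv ℝ f x (EuclideanSpace.single i 1)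

variable (g : EuclideanSpace ℝ (Fin n) → Matrix (Fin n) (Fin n) ℝ)

/-- The Christoffel symbol `Γ^k_ij` of the Levi-Civita connection of `g`. -/
def christoffel (k i j : Fin n) (x : EuclideanSpace ℝ (Fin n)) : ℝ :=
  (1 / 2) * ∑ l, (g x)⁻¹ k l *
    (pderiv i (fun y => g y j l) x + pderiv j (fun y => g y i l) x - pderiv l (fun y => g y i j) x)

/-- The component `R^l_kij` of the Riemann tensor: `R(∂_i, ∂_j) ∂_k = ∑ l, R^l_kij ∂_l`, where
`R(X, Y) = [∇_X, ∇_Y] - ∇_[X, Y]`. -/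
def riemann (l k i j : Fin n) (x : EuclideanSpace ℝ (Fin n)) : ℝ :=
  pderiv i (christoffel g l j k) x - pderiv j (christoffel g l i k) x
    + ∑ m, (christoffel g l i m x * christoffel g m j k x
      - christoffel g l j m x * christoffel g m i k x)

/-- `g_x(u, v)`. -/
def metricForm (x u v : EuclideanSpace ℝ (Fin n)) : ℝ := ∑ i, ∑ j, g x i j * u i * v j

/-- `R(u, v) w` at `x`. -/
def riemannVec (x u v w : EuclideanSpace ℝ (Fin n)) : EuclideanSpace ℝ (Fin n) :=
  WithLp.toLp 2 fun l => ∑ k, ∑ i, ∑ j, riemann g l k i j x * u i * v j * w k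

/-- The sectional curvature at `x` of the plane spanned by `u` and `v`. -/
def sectionalCurvature (x u v : EuclideanSpace ℝ (Fin n)) : ℝ :=
  metricForm g x (riemannVec g x u v v) u /
    (metricForm g x u u * metricForm g x v v - metricForm g x u v ^ 2)

end Curvature

/-- The set of all sectional curvatures `K_Q(p)(π)`, where `π` runs over the planes in `T_p Q`. -/
def sectionalCurvatures {d : ℕ} {G : Subgroup (Sp d)} {hG : IsClosed (G : Set (Sp d))}
    {c : Fin 3 → HMat d} (p : QuotSpace G hG c) : Set ℝ :=
  {K | ∃ (φ : Chart G hG c) (x : φ.source) (u v : EuclideanSpace ℝ (Fin (quotDim G hG))),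
    φ.point x = p ∧ LinearIndependent ℝ ![u, v] ∧ K = sectionalCurvature φ.metric x u v}

/-- The curvature of `Q` is asymptotically null: the sectional curvatures tend uniformly to zero at
infinity, i.e. they are smaller than any given `ε > 0` outside a compact subset of `Q`. -/
def AsymptoticallyNullCurvature {d : ℕ} (G : Subgroup (Sp d)) (hG : IsClosed (G : Set (Sp d)))
    (c : Fin 3 → HMat d) : Prop :=
  ∀ ε > 0, ∃ C : Set (QuotSpace G hG c), IsCompact C ∧
    ∀ p ∉ C, ∀ K ∈ sectionalCurvatures p, |K| < ε

end HKQuot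

end

namespace HKQuot

local notation:max "𝔼" n:max => EuclideanSpace ℝ (Fin n)

section Cartan

variable {𝔸 : Type*} [NormedRing 𝔸] [NormedAlgebra ℝ 𝔸] [FiniteDimensional ℝ 𝔸]

theorem exp_mul_exp_neg' (X : 𝔸) : NormedSpace.exp X * NormedSpace.exp (-X) = 1 := by
  have : CompleteSpace 𝔸 := FiniteDimensional.complete ℝ 𝔸
  let _ : NormedAlgebra ℚ 𝔸 := NormedAlgebra.restrictScalars ℚ ℝ 𝔸
  rw [← NormedSpace.exp_add_of_commute (Commute.neg_right (Commute.refl X)), add_neg_cancel,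
    NormedSpace.exp_zero]

theorem exp_neg_mul_exp' (X : 𝔸) : NormedSpace.exp (-X) * NormedSpace.exp X = 1 := by
  simpa using exp_mul_exp_neg' (-X)

/-- A limit direction of a null sequence in the logarithm of a closed submonoid generates a
one-parameter subsemigroup. -/
theorem exp_smul_mem_of_tendsto {S : Set 𝔸} (hS : IsClosed S) (h1 : (1 : 𝔸) ∈ S)
    (hmul : ∀ x ∈ S, ∀ y ∈ S, x * y ∈ S) {Y : ℕ → 𝔸} (hY : Tendsto Y atTop (𝓝 0))
    (hY0 : ∀ n, Y n ≠ 0) (hYS : ∀ n, NormedSpace.exp (Y n) ∈ S) {u : 𝔸}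
    (hu : Tendsto (fun n => ‖Y n‖⁻¹ • Y n) atTop (𝓝 u)) {t : ℝ} (ht : 0 ≤ t) :
    NormedSpace.exp (t • u) ∈ S := by
  have : CompleteSpace 𝔸 := FiniteDimensional.complete ℝ 𝔸
  let _ : NormedAlgebra ℚ 𝔸 := NormedAlgebra.restrictScalars ℚ ℝ 𝔸
  have hpow : ∀ x ∈ S, ∀ k : ℕ, x ^ k ∈ S := by
    intro x hx k
    induction k with
    | zero => simpa using h1
    | succ k ih => rw [pow_succ]; exact hmul _ ih _ hx
  have hpos : ∀ n, 0 < ‖Y n‖ := fun n => norm_pos_iff.2 (hY0 n)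
  have hk : Tendsto (fun n => (⌊t / ‖Y n‖⌋₊ : ℝ) * ‖Y n‖) atTop (𝓝 t) := by
    have hlow : Tendsto (fun n => t - ‖Y n‖) atTop (𝓝 t) := by
      simpa using (tendsto_const_nhds (x := t)).sub hY.norm
    refine tendsto_of_tendsto_of_tendsto_of_le_of_le hlow tendsto_const_nhds ?_ ?_
    · intro n
      have h := (Nat.lt_floor_add_one (t / ‖Y n‖)).le
      rw [div_le_iff₀ (hpos n)] at h
      change t - ‖Y n‖ ≤ _
      linarith
    · intro n
      have h := Nat.floor_le (div_nonneg ht (hpos n).le)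
      exact (le_div_iff₀ (hpos n)).1 h
  have hlim : Tendsto (fun n => NormedSpace.exp (⌊t / ‖Y n‖⌋₊ • Y n)) atTop
      (𝓝 (NormedSpace.exp (t • u))) := by
    refine (NormedSpace.exp_continuous.tendsto _).comp ((hk.smul hu).congr fun n => ?_)
    rw [smul_smul, mul_assoc, mul_inv_cancel₀ (hpos n).ne', mul_one, Nat.cast_smul_eq_nsmul]
  refine hS.mem_of_tendsto hlim (Eventually.of_forall fun n => ?_)
  rw [NormedSpace.exp_nsmul]
  exact hpow _ (hYS n) _

/-- Cartan's theorem: a closed subgroup of the units of a finite-dimensional algebra is, near `1`,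
the image of a neighbourhood of `0` in its Lie algebra under the exponential map. -/
theorem eventually_exists_exp_eq {S : Set 𝔸} (hS : IsClosed S) (h1 : (1 : 𝔸) ∈ S)
    (hmul : ∀ x ∈ S, ∀ y ∈ S, x * y ∈ S) (hinv : ∀ x ∈ S, ∀ y, x * y = 1 → y ∈ S)
    (𝔥 : Submodule ℝ 𝔸) (h𝔥 : ∀ X, X ∈ 𝔥 ↔ ∀ t : ℝ, NormedSpace.exp (t • X) ∈ S)
    {ε : ℝ} (hε : 0 < ε) :
    ∀ᶠ g in 𝓝 (1 : 𝔸), g ∈ S → ∃ X ∈ 𝔥, ‖X‖ < ε ∧ NormedSpace.exp X = g := by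
  have : CompleteSpace 𝔸 := FiniteDimensional.complete ℝ 𝔸
  have : ProperSpace 𝔸 := FiniteDimensional.proper ℝ 𝔸
  let _ : NormedAlgebra ℚ 𝔸 := NormedAlgebra.restrictScalars ℚ ℝ 𝔸
  have h𝔥1 : ∀ X ∈ 𝔥, NormedSpace.exp X ∈ S := fun X hX => by simpa using (h𝔥 X).1 hX 1
  obtain ⟨W, hW⟩ := 𝔥.exists_isCompl
  have claim : ∀ᶠ Y in 𝓝 (0 : 𝔸), Y ∈ W → NormedSpace.exp Y ∈ S → Y = 0 := by
    by_contra hcon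
    rw [not_eventually] at hcon
    obtain ⟨Y, hY, hYp⟩ := exists_seq_forall_of_frequently hcon
    push Not at hYp
    have hpos : ∀ n, 0 < ‖Y n‖ := fun n => norm_pos_iff.2 (hYp n).2.2
    have hsph : ∀ n, ‖Y n‖⁻¹ • Y n ∈ Metric.sphere (0 : 𝔸) 1 := fun n => by
      simp [norm_smul, (hpos n).ne']
    obtain ⟨u, hu, φ, hφ, hlim⟩ := (isCompact_sphere (0 : 𝔸) 1).tendsto_subseq hsph
    have hpos_mem : ∀ t : ℝ, 0 ≤ t → NormedSpace.exp (t • u) ∈ S := fun t ht =>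
      exp_smul_mem_of_tendsto hS h1 hmul (hY.comp hφ.tendsto_atTop) (fun n => (hYp (φ n)).2.2)
        (fun n => (hYp (φ n)).2.1) hlim ht
    have hu𝔥 : u ∈ 𝔥 := by
      refine (h𝔥 u).2 fun t => ?_
      rcases le_total 0 t with ht | ht
      · exact hpos_mem t ht
      · refine hinv _ (hpos_mem (-t) (by linarith)) _ ?_
        rw [neg_smul, exp_neg_mul_exp']
    have huW : u ∈ W := (Submodule.closed_of_finiteDimensional W).mem_of_tendsto hlim
      (Eventually.of_forall fun n => W.smul_mem _ (hYp (φ n)).1)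
    have hu0 : u = 0 := by
      have : u ∈ 𝔥 ⊓ W := ⟨hu𝔥, huW⟩
      rwa [hW.inf_eq_bot, Submodule.mem_bot] at this
    simp [hu0] at hu
  set P : 𝔸 →L[ℝ] 𝔸 := LinearMap.toContinuousLinearMap (𝔥.projection W hW) with hP
  have hP𝔥 : ∀ Z, P Z ∈ 𝔥 := fun Z => by
    exact Submodule.projection_apply_mem hW Z
  have hPW : ∀ Z, Z - P Z ∈ W := fun Z => by
    have : Z - P Z ∈ LinearMap.ker (𝔥.projection W hW) := by
      rw [LinearMap.mem_ker, map_sub, sub_eq_zero]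
      exact ((Submodule.projection_eq_self_iff hW _).2 (hP𝔥 Z)).symm
    rwa [Submodule.ker_projection] at this
  have hexp0 : HasStrictFDerivAt (NormedSpace.exp : 𝔸 → 𝔸) (1 : 𝔸 →L[ℝ] 𝔸) 0 :=
    hasStrictFDerivAt_exp_zero
  have hf : HasStrictFDerivAt (fun Z => NormedSpace.exp (P Z) * NormedSpace.exp (Z - P Z))
      ((ContinuousLinearEquiv.refl ℝ 𝔸 : 𝔸 ≃L[ℝ] 𝔸) : 𝔸 →L[ℝ] 𝔸) 0 := by
    have a : HasStrictFDerivAt (fun Z => NormedSpace.exp (P Z)) P 0 := by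
      have := HasStrictFDerivAt.comp (g := NormedSpace.exp) (f := P) (x := (0 : 𝔸)) (g' := 1)
        (by rw [map_zero]; exact hexp0) P.hasStrictFDerivAt
      exact this
    have b : HasStrictFDerivAt (fun Z => NormedSpace.exp (Z - P Z))
        (ContinuousLinearMap.id ℝ 𝔸 - P) 0 := by
      have := HasStrictFDerivAt.comp (g := NormedSpace.exp)
        (f := (ContinuousLinearMap.id ℝ 𝔸 - P : 𝔸 →L[ℝ] 𝔸)) (x := (0 : 𝔸)) (g' := 1)
        (by rw [map_zero]; exact hexp0) (ContinuousLinearMap.id ℝ 𝔸 - P).hasStrictFDerivAt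
      exact this
    refine (a.mul' b).congr_fderiv ?_
    ext Z
    simp
  have hnhds := hf.map_nhds_eq_of_equiv
  simp only [map_zero, sub_zero, NormedSpace.exp_zero, mul_one] at hnhds
  rw [← hnhds, eventually_map]
  have hQ0 : Tendsto (fun Z => Z - P Z) (𝓝 0) (𝓝 0) := by
    have h : Continuous fun Z => Z - P Z := by fun_prop
    simpa using h.tendsto 0
  have hP0 : Tendsto (fun Z => ‖P Z‖) (𝓝 0) (𝓝 0) := by
    have := P.continuous.norm.tendsto 0
    simpa using this
  filter_upwards [hQ0.eventually claim, hP0.eventually (gt_mem_nhds hε)] with Z hZ hZε hZS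
  have hmem : NormedSpace.exp (Z - P Z) ∈ S := by
    have := hmul _ (h𝔥1 _ (𝔥.neg_mem (hP𝔥 Z))) _ hZS
    rwa [← mul_assoc, exp_neg_mul_exp', one_mul] at this
  have h0 := hZ (hPW Z) hmem
  exact ⟨P Z, hP𝔥 Z, hZε, by rw [h0, NormedSpace.exp_zero, mul_one]⟩

end Cartan

/-! ## The Riemann tensor of a metric given by a frame with a skew connection -/

section MatrixSmooth

variable {E : Type*} [NormedAddCommGroup E] [NormedSpace ℝ E] {n : ℕ}

theorem differentiableAt_det {ι : Type*} [Fintype ι] [DecidableEq ι] {g : E → Matrix ι ι ℝ} {x : E}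
    (hg : ∀ i j, DifferentiableAt ℝ (fun y => g y i j) x) :
    DifferentiableAt ℝ (fun y => (g y).det) x := by
  simp only [Matrix.det_apply]
  refine DifferentiableAt.fun_sum fun σ _ => ?_
  refine DifferentiableAt.const_smul ?_ _
  exact (HasFDerivAt.finsetProd fun i _ => (hg (σ i) i).hasFDerivAt).differentiableAt

theorem differentiableAt_inv {ι : Type*} [Fintype ι] [DecidableEq ι] {g : E → Matrix ι ι ℝ} {x : E}
    (hg : ∀ i j, DifferentiableAt ℝ (fun y => g y i j) x) (hdet : (g x).det ≠ 0) (i j : ι) :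
    DifferentiableAt ℝ (fun y => (g y)⁻¹ i j) x := by
  simp only [Matrix.inv_def, Ring.inverse_eq_inv', Matrix.smul_apply, smul_eq_mul,
    Matrix.adjugate_apply]
  refine ((differentiableAt_det hg).inv hdet).mul (differentiableAt_det fun a b => ?_)
  simp only [Matrix.updateRow_apply]
  split_ifs
  · exact differentiableAt_const _
  · exact hg a b

end MatrixSmooth

variable {n : ℕ} {V : Type*} [NormedAddCommGroup V] [InnerProductSpace ℝ V]

/-- The covariant derivative `∂_u Y - A_u Y` along the constant vector field `u`. -/
noncomputable def covD (A : 𝔼 n → 𝔼 n → V →L[ℝ] V)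
    (u : 𝔼 n) (Y : 𝔼 n → V)
    (x : 𝔼 n) : V :=
  fderiv ℝ Y x u - A u x (Y x)

/-- The curvature `∂_u A_v - ∂_v A_u - [A_u, A_v]` of the connection `A`. -/
noncomputable def curvF (A : 𝔼 n → 𝔼 n → V →L[ℝ] V)
    (u v x : 𝔼 n) : V →L[ℝ] V :=
  fderiv ℝ (A v) x u - fderiv ℝ (A u) x v - (A u x * A v x - A v x * A u x)

theorem fderiv_inner_eq_covD {A : 𝔼 n → 𝔼 n → V →L[ℝ] V} {u x : 𝔼 n} {Y Z : 𝔼 n → V}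
    (hA : ∀ v w, inner ℝ (A u x v) w = -inner ℝ v (A u x w))
    (hY : DifferentiableAt ℝ Y x) (hZ : DifferentiableAt ℝ Z x) :
    fderiv ℝ (fun y => inner ℝ (Y y) (Z y)) x u =
      inner ℝ (covD A u Y x) (Z x) + inner ℝ (Y x) (covD A u Z x) := by
  rw [fderiv_inner_apply ℝ hY hZ]
  simp only [covD, inner_sub_left, inner_sub_right, hA]
  ring

theorem covD_comm {A : 𝔼 n → 𝔼 n → V →L[ℝ] V} {U : Set 𝔼 n} (hU : IsOpen U) {x : 𝔼 n} (hx : x ∈ U)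
    (hA : ∀ u, ContDiffOn ℝ ∞ (A u) U) {Y : 𝔼 n → V} (hY : ContDiffOn ℝ ∞ Y U) (u v : 𝔼 n) :
    covD A u (covD A v Y) x - covD A v (covD A u Y) x = -curvF A u v x (Y x) := by
  have hYx : ContDiffAt ℝ ∞ Y x := hY.contDiffAt (hU.mem_nhds hx)
  have hY1 : DifferentiableAt ℝ Y x := hYx.differentiableAt (by simp)
  have hY2 : DifferentiableAt ℝ (fderiv ℝ Y) x :=
    (hYx.fderiv_right (m := 1) (by norm_cast)).differentiableAt (by simp)
  have hA1 : ∀ u, DifferentiableAt ℝ (A u) x := fun u =>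
    ((hA u).contDiffAt (hU.mem_nhds hx)).differentiableAt (by simp)
  have key : ∀ u v, fderiv ℝ (covD A v Y) x u =
      fderiv ℝ (fderiv ℝ Y) x u v - (fderiv ℝ (A v) x u (Y x) + A v x (fderiv ℝ Y x u)) := by
    intro u v
    have e1 : HasFDerivAt (fun y => fderiv ℝ Y y v)
        ((fderiv ℝ (fderiv ℝ Y) x).flip v) x := by
      simpa using hY2.hasFDerivAt.clm_apply (hasFDerivAt_const v x)
    have e2 := (hA1 v).hasFDerivAt.clm_apply hY1.hasFDerivAt
    have := (e1.sub e2).fderiv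
    change fderiv ℝ (covD A v Y) x = _ at this
    rw [this]
    simp only [_root_.sub_apply, _root_.add_apply,
      ContinuousLinearMap.flip_apply, ContinuousLinearMap.comp_apply]
    abel
  have hsymm : fderiv ℝ (fderiv ℝ Y) x u v = fderiv ℝ (fderiv ℝ Y) x v u :=
    (hYx.isSymmSndFDerivAt (by simp; norm_cast)).eq u v
  have e : ∀ u v, covD A u (covD A v Y) x =
      fderiv ℝ (covD A v Y) x u - A u x (fderiv ℝ Y x v - A v x (Y x)) := fun u v => rfl
  rw [e, e, key, key, hsymm]
  simp only [curvF, map_sub, _root_.sub_apply, mul_apply_eq_comp]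
  abel

/-- A smooth frame `X` with a skew connection `A` on the open set `U`, without torsion along the
span of the frame, whose Gram matrix is the metric `g`. -/
structure FrameMetric (g : 𝔼 n → Matrix (Fin n) (Fin n) ℝ)
    (U : Set 𝔼 n)
    (A : 𝔼 n → 𝔼 n → V →L[ℝ] V)
    (X : Fin n → 𝔼 n → V) : Prop where
  isOpen : IsOpen U
  smooth_conn : ∀ u, ContDiffOn ℝ ∞ (A u) U
  smooth_frame : ∀ i, ContDiffOn ℝ ∞ (X i) U
  skew : ∀ u, ∀ x ∈ U, ∀ v w, inner ℝ (A u x v) w = -inner ℝ v (A u x w)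
  metric_eq : ∀ x ∈ U, ∀ i j, g x i j = inner ℝ (X i x) (X j x)
  det_ne_zero : ∀ x ∈ U, (g x).det ≠ 0
  torsion : ∀ x ∈ U, ∀ i j k,
    inner ℝ (covD A (EuclideanSpace.single i 1) (X j) x) (X k x) =
      inner ℝ (covD A (EuclideanSpace.single j 1) (X i) x) (X k x)

namespace FrameMetric

variable {g : 𝔼 n → Matrix (Fin n) (Fin n) ℝ}
  {U : Set 𝔼 n}
  {A : 𝔼 n → 𝔼 n → V →L[ℝ] V}
  {X : Fin n → 𝔼 n → V} (h : FrameMetric g U A X)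
  {x : 𝔼 n} (hx : x ∈ U)

local notation "∇[" i "]" => covD A (EuclideanSpace.single i (1 : ℝ))

include h hx

theorem differentiableAt_frame (i : Fin n) : DifferentiableAt ℝ (X i) x :=
  ((h.smooth_frame i).contDiffAt (h.isOpen.mem_nhds hx)).differentiableAt (by simp)

theorem differentiableAt_covD (u : 𝔼 n) (j : Fin n) : DifferentiableAt ℝ (covD A u (X j)) x := by
  have hX := (h.smooth_frame j).contDiffAt (h.isOpen.mem_nhds hx)
  have h1 : DifferentiableAt ℝ (fderiv ℝ (X j)) x :=
    (hX.fderiv_right (m := 1) (by norm_cast)).differentiableAt (by simp)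
  have h2 : DifferentiableAt ℝ (A u) x :=
    ((h.smooth_conn u).contDiffAt (h.isOpen.mem_nhds hx)).differentiableAt (by simp)
  exact (h1.clm_apply (differentiableAt_const _)).sub (h2.clm_apply (h.differentiableAt_frame hx j))

theorem differentiableAt_metric (i j : Fin n) : DifferentiableAt ℝ (fun y => g y i j) x := by
  refine ((h.differentiableAt_frame hx i).inner ℝ
    (h.differentiableAt_frame hx j)).congr_of_eventuallyEq ?_
  filter_upwards [h.isOpen.mem_nhds hx] with y hy using h.metric_eq y hy i j

theorem pderiv_metric (l i j : Fin n) : pderiv l (fun y => g y i j) x =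
    inner ℝ (∇[l] (X i) x) (X j x) + inner ℝ (X i x) (∇[l] (X j) x) := by
  have : (fun y => g y i j) =ᶠ[𝓝 x] fun y => inner ℝ (X i y) (X j y) := by
    filter_upwards [h.isOpen.mem_nhds hx] with y hy using h.metric_eq y hy i j
  rw [pderiv, this.fderiv_eq]
  exact fderiv_inner_eq_covD (h.skew _ x hx) (h.differentiableAt_frame hx i)
    (h.differentiableAt_frame hx j)

theorem christoffel_eq (k i j : Fin n) :
    christoffel g k i j x = ∑ l, (g x)⁻¹ k l * inner ℝ (∇[i] (X j) x) (X l x) := by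
  rw [christoffel, Finset.mul_sum]
  refine Finset.sum_congr rfl fun l _ => ?_
  rw [h.pderiv_metric hx, h.pderiv_metric hx, h.pderiv_metric hx]
  have t1 := h.torsion x hx i j l
  have t2 := h.torsion x hx i l j
  have t3 := h.torsion x hx j l i
  simp only [real_inner_comm (X j x), real_inner_comm (X i x)] at *
  rw [t2, t3, t1]
  ring

theorem sum_metric_mul_christoffel (p i j : Fin n) :
    ∑ k, g x p k * christoffel g k i j x = inner ℝ (∇[i] (X j) x) (X p x) := by
  have hu : IsUnit (g x).det := (h.det_ne_zero x hx).isUnit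
  simp only [h.christoffel_eq hx]
  have : (g x * (g x)⁻¹) *ᵥ (fun l => inner ℝ (∇[i] (X j) x) (X l x)) =
      fun l => inner ℝ (∇[i] (X j) x) (X l x) := by
    rw [Matrix.mul_nonsing_inv _ hu, Matrix.one_mulVec]
  rw [← Matrix.mulVec_mulVec] at this
  exact congrFun this p

theorem differentiableAt_christoffel (k i j : Fin n) :
    DifferentiableAt ℝ (christoffel g k i j) x := by
  have : christoffel g k i j =ᶠ[𝓝 x]
      fun y => ∑ l, (g y)⁻¹ k l * inner ℝ (∇[i] (X j) y) (X l y) := by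
    filter_upwards [h.isOpen.mem_nhds hx] with y hy using h.christoffel_eq hy k i j
  refine DifferentiableAt.congr_of_eventuallyEq ?_ this
  refine DifferentiableAt.fun_sum fun l _ => ?_
  exact (differentiableAt_inv (h.differentiableAt_metric hx) (h.det_ne_zero x hx) k l).mul
    ((h.differentiableAt_covD hx _ j).inner ℝ (h.differentiableAt_frame hx l))

theorem sum_metric_mul_pderiv_christoffel (p a i j : Fin n) :
    ∑ k, g x p k * pderiv a (christoffel g k i j) x =
      inner ℝ (∇[a] (∇[i] (X j)) x) (X p x) + inner ℝ (∇[i] (X j) x) (∇[a] (X p) x)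
        - ∑ k, (inner ℝ (∇[a] (X p) x) (X k x) + inner ℝ (X p x) (∇[a] (X k) x)) *
          christoffel g k i j x := by
  have e : (fun y => ∑ k, g y p k * christoffel g k i j y) =ᶠ[𝓝 x]
      fun y => inner ℝ (∇[i] (X j) y) (X p y) := by
    filter_upwards [h.isOpen.mem_nhds hx] with y hy using h.sum_metric_mul_christoffel hy p i j
  have e1 := congrArg (fun L : 𝔼 n →L[ℝ] ℝ => L (EuclideanSpace.single a (1 : ℝ))) e.fderiv_eq
  rw [fderiv_inner_eq_covD (h.skew _ x hx) (h.differentiableAt_covD hx _ j)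
    (h.differentiableAt_frame hx p), fderiv_fun_sum (A := fun k y => g y p k * christoffel g k i j y)
      fun k _ => (h.differentiableAt_metric hx p k).mul
        (h.differentiableAt_christoffel hx k i j)] at e1
  simp only [_root_.sum_apply] at e1
  rw [eq_sub_iff_add_eq, ← e1, ← Finset.sum_add_distrib]
  refine Finset.sum_congr rfl fun k _ => ?_
  rw [fderiv_fun_mul (h.differentiableAt_metric hx p k) (h.differentiableAt_christoffel hx k i j)]
  have := h.pderiv_metric hx a p k
  rw [pderiv] at this
  simp only [_root_.add_apply, _root_.smul_apply, smul_eq_mul, this,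
    pderiv]
  ring

end FrameMetric

/-- The component of `∇_i X_j` orthogonal to the frame. -/
noncomputable def secondForm (g : 𝔼 n → Matrix (Fin n) (Fin n) ℝ)
    (A : 𝔼 n → 𝔼 n → V →L[ℝ] V)
    (X : Fin n → 𝔼 n → V) (x : 𝔼 n) (i j : Fin n) : V :=
  covD A (EuclideanSpace.single i 1) (X j) x - ∑ m, christoffel g m i j x • X m x

namespace FrameMetric

variable {g : 𝔼 n → Matrix (Fin n) (Fin n) ℝ}
  {U : Set 𝔼 n}
  {A : 𝔼 n → 𝔼 n → V →L[ℝ] V}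
  {X : Fin n → 𝔼 n → V} (h : FrameMetric g U A X)
  {x : 𝔼 n} (hx : x ∈ U)

local notation "∇[" i "]" => covD A (EuclideanSpace.single i (1 : ℝ))

include h hx

theorem inner_secondForm (i j p : Fin n) : inner ℝ (secondForm g A X x i j) (X p x) = 0 := by
  rw [secondForm, inner_sub_left, sum_inner, ← h.sum_metric_mul_christoffel hx, sub_eq_zero]
  refine Finset.sum_congr rfl fun k _ => ?_
  rw [inner_smul_left, h.metric_eq x hx, real_inner_comm]
  simp [mul_comm]

theorem inner_secondForm_covD (i j a p : Fin n) :
    inner ℝ (secondForm g A X x i j) (∇[a] (X p) x) =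
      inner ℝ (secondForm g A X x i j) (secondForm g A X x a p) := by
  have : inner ℝ (secondForm g A X x i j) (∑ m, christoffel g m a p x • X m x) = 0 := by
    rw [inner_sum]
    simp [inner_smul_right, h.inner_secondForm hx]
  rw [secondForm.eq_1 g A X x a p, inner_sub_right, this, sub_zero]

/-- The Gauss equation for the metric `g`. -/
theorem sum_metric_mul_riemann (p k i j : Fin n) :
    ∑ l, g x p l * riemann g l k i j x =
      -inner ℝ (curvF A (EuclideanSpace.single i 1) (EuclideanSpace.single j 1) x (X k x)) (X p x)
        + inner ℝ (secondForm g A X x j k) (secondForm g A X x i p)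
        - inner ℝ (secondForm g A X x i k) (secondForm g A X x j p) := by
  have c := congrArg (fun v => inner ℝ v (X p x))
    (covD_comm h.isOpen hx h.smooth_conn (h.smooth_frame k) (EuclideanSpace.single i (1 : ℝ))
      (EuclideanSpace.single j (1 : ℝ)))
  simp only [inner_sub_left, inner_neg_left] at c
  have q : ∀ i j a, ∑ l, g x p l * ∑ m, christoffel g l i m x * christoffel g m j a x =
      ∑ m, inner ℝ (X p x) (∇[i] (X m) x) * christoffel g m j a x := by
    intro i j a
    simp only [Finset.mul_sum]
    rw [Finset.sum_comm]
    refine Finset.sum_congr rfl fun m _ => ?_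
    rw [real_inner_comm, ← h.sum_metric_mul_christoffel hx p i m, Finset.sum_mul]
    exact Finset.sum_congr rfl fun l _ => by ring
  have s : ∀ i j, inner ℝ (secondForm g A X x j k) (secondForm g A X x i p) =
      inner ℝ (∇[j] (X k) x) (∇[i] (X p) x) -
        ∑ m, inner ℝ (∇[i] (X p) x) (X m x) * christoffel g m j k x := by
    intro i j
    rw [← h.inner_secondForm_covD hx, secondForm, inner_sub_left, sum_inner]
    congr 1
    refine Finset.sum_congr rfl fun m _ => ?_
    rw [inner_smul_left, real_inner_comm]
    simp [mul_comm]
  rw [← c, s i j, s j i]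
  simp only [riemann, mul_add, mul_sub, Finset.sum_add_distrib, Finset.sum_sub_distrib, q,
    h.sum_metric_mul_pderiv_christoffel hx, add_mul]
  ring

end FrameMetric

/-! ## Curvature of the frame metric on arbitrary planes -/

section Multilinear

variable {n : ℕ} {M : Type*} [AddCommGroup M] [Module ℝ M]

/-- The linear map with values `X i` on the standard basis. -/
noncomputable def linExt (X : Fin n → M) : 𝔼 n →ₗ[ℝ] M where
  toFun u := ∑ i, u i • X i
  map_add' u v := by simp [add_smul, Finset.sum_add_distrib]
  map_smul' r u := by simp [mul_smul, Finset.smul_sum]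

/-- The bilinear map with values `B i j` on the standard basis. -/
noncomputable def bilinExt (B : Fin n → Fin n → M) :
    𝔼 n →ₗ[ℝ] 𝔼 n →ₗ[ℝ] M :=
  linExt fun i => linExt (B i)

theorem linExt_apply (X : Fin n → M) (u : EuclideanSpace ℝ (Fin n)) :
    linExt X u = ∑ i, u i • X i := rfl

theorem bilinExt_apply (B : Fin n → Fin n → M) (u v : 𝔼 n) :
    bilinExt B u v = ∑ i, ∑ j, (u i * v j) • B i j := by
  simp [bilinExt, linExt_apply, LinearMap.sum_apply, Finset.smul_sum, smul_smul]

theorem eq_linExt (L : 𝔼 n →ₗ[ℝ] M) (u : 𝔼 n) :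
    L u = linExt (fun i => L (EuclideanSpace.single i 1)) u := by
  conv_lhs => rw [← (EuclideanSpace.basisFun (Fin n) ℝ).sum_repr u]
  simp [linExt_apply]

end Multilinear

variable {n : ℕ} {V : Type*} [NormedAddCommGroup V] [InnerProductSpace ℝ V]

theorem inner_bilinExt (B C : Fin n → Fin n → V) (a b c d : 𝔼 n) :
    inner ℝ (bilinExt B a b) (bilinExt C c d) =
      ∑ i, ∑ j, ∑ k, ∑ l, a i * b j * c k * d l * inner ℝ (B i j) (C k l) := by
  simp only [bilinExt_apply, sum_inner]
  refine Finset.sum_congr rfl fun i _ => Finset.sum_congr rfl fun j _ => ?_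
  simp only [inner_sum, inner_smul_left, inner_smul_right]
  refine Finset.sum_congr rfl fun k _ => Finset.sum_congr rfl fun l _ => ?_
  simp
  ring

theorem inner_bilinExt_apply (F : Fin n → Fin n → V →L[ℝ] V) (X : Fin n → V) (u v w z : 𝔼 n) :
    inner ℝ (bilinExt F u v (linExt X w)) (linExt X z) =
      ∑ i, ∑ j, ∑ k, ∑ l, u i * v j * w k * z l * inner ℝ (F i j (X k)) (X l) := by
  simp only [bilinExt_apply, linExt_apply, _root_.sum_apply, sum_inner]
  refine Finset.sum_congr rfl fun i _ => Finset.sum_congr rfl fun j _ => ?_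
  simp only [_root_.smul_apply, map_sum, map_smul, inner_sum, inner_smul_left, inner_smul_right,
    sum_inner, Finset.mul_sum]
  rw [Finset.sum_comm]
  refine Finset.sum_congr rfl fun k _ => Finset.sum_congr rfl fun l _ => ?_
  simp
  ring

theorem metricForm_riemannVec {g : 𝔼 n → Matrix (Fin n) (Fin n) ℝ} {x : 𝔼 n}
    (hg : ∀ i j, g x i j = g x j i) (u v w z : 𝔼 n) :
    metricForm g x (riemannVec g x u v w) z =
      ∑ i, ∑ j, ∑ k, ∑ p, u i * v j * w k * z p * ∑ l, g x p l * riemann g l k i j x := by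
  simp only [metricForm, riemannVec, Finset.mul_sum, Finset.sum_mul]
  have comm3 : ∀ f : Fin n → Fin n → Fin n → Fin n → ℝ,
      ∑ l, ∑ k, ∑ i, ∑ j, f l k i j = ∑ i, ∑ j, ∑ k, ∑ l, f l k i j := by
    intro f
    have e1 : ∀ l, ∑ k, ∑ i, ∑ j, f l k i j = ∑ i, ∑ j, ∑ k, f l k i j := by
      intro l
      rw [Finset.sum_comm]
      exact Finset.sum_congr rfl fun i _ => Finset.sum_comm
    simp only [e1]
    rw [Finset.sum_comm]
    refine Finset.sum_congr rfl fun i _ => ?_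
    rw [Finset.sum_comm]
    exact Finset.sum_congr rfl fun j _ => Finset.sum_comm
  rw [Finset.sum_comm]
  refine (Finset.sum_congr rfl fun p _ => comm3 _).trans ?_
  rw [Finset.sum_comm]
  refine Finset.sum_congr rfl fun i _ => ?_
  rw [Finset.sum_comm]
  refine Finset.sum_congr rfl fun j _ => ?_
  rw [Finset.sum_comm]
  refine Finset.sum_congr rfl fun k _ => Finset.sum_congr rfl fun p _ =>
    Finset.sum_congr rfl fun l _ => ?_
  rw [hg p l]
  ring

namespace FrameMetric

variable {g : 𝔼 n → Matrix (Fin n) (Fin n) ℝ}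
  {U : Set 𝔼 n}
  {A : 𝔼 n → 𝔼 n → V →L[ℝ] V}
  {X : Fin n → 𝔼 n → V} (h : FrameMetric g U A X)
  {x : 𝔼 n} (hx : x ∈ U)

include h hx

theorem metricForm_eq (u v : 𝔼 n) :
    metricForm g x u v = inner ℝ (linExt (fun i => X i x) u) (linExt (fun i => X i x) v) := by
  simp only [metricForm, linExt_apply, sum_inner, inner_sum, inner_smul_left, inner_smul_right,
    h.metric_eq x hx, Finset.mul_sum]
  rw [Finset.sum_comm]
  refine Finset.sum_congr rfl fun i _ => Finset.sum_congr rfl fun j _ => ?_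
  simp
  ring

theorem metricForm_riemannVec_eq (u v w z : 𝔼 n) :
    metricForm g x (riemannVec g x u v w) z =
      -inner ℝ (bilinExt (fun i j => curvF A (EuclideanSpace.single i 1)
          (EuclideanSpace.single j 1) x) u v (linExt (fun i => X i x) w))
        (linExt (fun i => X i x) z)
      + inner ℝ (bilinExt (secondForm g A X x) v w) (bilinExt (secondForm g A X x) u z)
      - inner ℝ (bilinExt (secondForm g A X x) u w) (bilinExt (secondForm g A X x) v z) := by
  rw [metricForm_riemannVec fun i j => by
    rw [h.metric_eq x hx, h.metric_eq x hx, real_inner_comm]]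
  simp only [h.sum_metric_mul_riemann hx, inner_bilinExt, inner_bilinExt_apply]
  have e1 : ∑ j, ∑ k, ∑ i, ∑ p, v j * w k * u i * z p *
        inner ℝ (secondForm g A X x j k) (secondForm g A X x i p) =
      ∑ i, ∑ j, ∑ k, ∑ p, v j * w k * u i * z p *
        inner ℝ (secondForm g A X x j k) (secondForm g A X x i p) := by
    rw [Finset.sum_comm (s := (Finset.univ : Finset (Fin n)))]
    conv_rhs => rw [Finset.sum_comm]
    rw [Finset.sum_comm]
    exact Finset.sum_congr rfl fun j _ => Finset.sum_comm
  have e2 : ∑ i, ∑ k, ∑ j, ∑ p, u i * w k * v j * z p *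
        inner ℝ (secondForm g A X x i k) (secondForm g A X x j p) =
      ∑ i, ∑ j, ∑ k, ∑ p, u i * w k * v j * z p *
        inner ℝ (secondForm g A X x i k) (secondForm g A X x j p) :=
    Finset.sum_congr rfl fun i _ => Finset.sum_comm
  rw [e1, e2]
  simp only [← Finset.sum_neg_distrib, ← Finset.sum_add_distrib, ← Finset.sum_sub_distrib]
  refine Finset.sum_congr rfl fun i _ => Finset.sum_congr rfl fun j _ =>
    Finset.sum_congr rfl fun k _ => Finset.sum_congr rfl fun p _ => ?_
  ring

end FrameMetric

/-- A bound for the quotient of a curvature-like form by the area form. -/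
theorem abs_curvature_quotient_le (X : 𝔼 n →ₗ[ℝ] V) (hX : ∀ u, X u = 0 → u = 0)
    (F : 𝔼 n →ₗ[ℝ] 𝔼 n →ₗ[ℝ] V →L[ℝ] V) (Q : 𝔼 n →ₗ[ℝ] 𝔼 n →ₗ[ℝ] V)
    (hFanti : ∀ u v, F u v = -F v u)
    (hFskew : ∀ u v a b, inner ℝ (F u v a) b = -inner ℝ a (F u v b)) {a b : ℝ}
    (hF : ∀ u v, ‖F u v‖ ≤ a * (‖X u‖ * ‖X v‖)) (hQ : ∀ u v, ‖Q u v‖ ≤ b * (‖X u‖ * ‖X v‖))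
    {u v : 𝔼 n} (huv : LinearIndependent ℝ ![u, v]) :
    |(-inner ℝ (F u v (X v)) (X u) + inner ℝ (Q v v) (Q u u) - inner ℝ (Q u v) (Q v u)) /
      (inner ℝ (X u) (X u) * inner ℝ (X v) (X v) - inner ℝ (X u) (X v) ^ 2)| ≤ a + 2 * b ^ 2 := by
  have hu : X u ≠ 0 := fun h0 => huv.ne_zero 0 (hX u h0)
  have hu2 : (inner ℝ (X u) (X u) : ℝ) ≠ 0 := by simpa using hu
  obtain ⟨t, w, rfl, horth⟩ : ∃ (t : ℝ) (w : 𝔼 n), v = w + t • u ∧ inner ℝ (X u) (X w) = (0 : ℝ) := by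
    refine ⟨inner ℝ (X u) (X v) / inner ℝ (X u) (X u),
      v - (inner ℝ (X u) (X v) / inner ℝ (X u) (X u) : ℝ) • u, by abel, ?_⟩
    rw [map_sub, map_smul, inner_sub_right, inner_smul_right, div_mul_cancel₀ _ hu2, sub_self]
  have hw : X w ≠ 0 := by
    intro h0
    have hw0 := hX w h0
    rw [hw0, zero_add] at huv
    have := LinearIndependent.pair_iff.1 huv t (-1) (by simp)
    simp at this
  have hFuu : F u u = 0 := by
    have := hFanti u u
    rwa [eq_neg_iff_add_eq_zero, ← two_smul ℝ, smul_eq_zero_iff_right (by norm_num)] at this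
  have hFw : inner ℝ (F u w (X u)) (X u) = (0 : ℝ) := by
    have := hFskew u w (X u) (X u)
    rw [real_inner_comm (X u)] at this
    linarith [real_inner_comm (F u w (X u)) (X u)]
  have hnum : -inner ℝ (F u (w + t • u) (X (w + t • u))) (X u)
        + inner ℝ (Q (w + t • u) (w + t • u)) (Q u u)
        - inner ℝ (Q u (w + t • u)) (Q (w + t • u) u) =
      -inner ℝ (F u w (X w)) (X u) + inner ℝ (Q w w) (Q u u) - inner ℝ (Q u w) (Q w u) := by
    simp only [map_add, map_smul, hFuu, smul_zero, add_zero, LinearMap.add_apply,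
      LinearMap.smul_apply, inner_add_left, inner_add_right, inner_smul_left, inner_smul_right, hFw]
    simp only [conj_trivial, real_inner_comm (Q u u)]
    ring
  have hden : (inner ℝ (X u) (X u) * inner ℝ (X (w + t • u)) (X (w + t • u))
      - inner ℝ (X u) (X (w + t • u)) ^ 2 : ℝ) = ‖X u‖ ^ 2 * ‖X w‖ ^ 2 := by
    simp only [map_add, map_smul, inner_add_left, inner_add_right, inner_smul_left,
      inner_smul_right, real_inner_comm (X u) (X w), horth, ← real_inner_self_eq_norm_sq]
    simp only [conj_trivial]
    ring
  have hpos : 0 < ‖X u‖ ^ 2 * ‖X w‖ ^ 2 := by positivity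
  rw [hnum, hden, abs_div, abs_of_pos hpos, div_le_iff₀ hpos]
  have b1 : |inner ℝ (F u w (X w)) (X u)| ≤ a * (‖X u‖ ^ 2 * ‖X w‖ ^ 2) := by
    calc |inner ℝ (F u w (X w)) (X u)| ≤ ‖F u w (X w)‖ * ‖X u‖ := abs_real_inner_le_norm _ _
      _ ≤ (a * (‖X u‖ * ‖X w‖) * ‖X w‖) * ‖X u‖ := by
        gcongr
        exact ((F u w).le_opNorm _).trans (by gcongr; exact hF u w)
      _ = _ := by ring
  have b2 : ∀ p q r s : 𝔼 n, |inner ℝ (Q p q) (Q r s)| ≤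
      b ^ 2 * (‖X p‖ * ‖X q‖ * (‖X r‖ * ‖X s‖)) := by
    intro p q r s
    calc |inner ℝ (Q p q) (Q r s)| ≤ ‖Q p q‖ * ‖Q r s‖ := abs_real_inner_le_norm _ _
      _ ≤ (b * (‖X p‖ * ‖X q‖)) * (b * (‖X r‖ * ‖X s‖)) :=
        mul_le_mul (hQ p q) (hQ r s) (norm_nonneg _) ((norm_nonneg _).trans (hQ p q))
      _ = _ := by ring
  have b3 := b2 w w u u
  have b4 := b2 u w w u
  rw [abs_le] at b1 b3 b4 ⊢
  constructor <;> nlinarith [b1.1, b1.2, b3.1, b3.2, b4.1, b4.2]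

/-! ## Horizontal frames of slices -/

section Slice

variable {V : Type*} [NormedAddCommGroup V] [InnerProductSpace ℝ V]

/-- A Lie algebra `𝔥` of skew operators commuting with the isometries `J 0 = 1, J 1, J 2, J 3`,
which multiply like the units of the quaternions. -/
structure IsQuaternionic (𝔥 : Submodule ℝ (V →L[ℝ] V)) (J : Fin 4 → V →L[ℝ] V) : Prop where
  skew : ∀ T ∈ 𝔥, ∀ v w, inner ℝ (T v) w = -inner ℝ v (T w)
  lie : ∀ T ∈ 𝔥, ∀ T' ∈ 𝔥, T * T' - T' * T ∈ 𝔥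
  J_zero : J 0 = 1
  J_comm : ∀ T ∈ 𝔥, ∀ l v, J l (T v) = T (J l v)
  J_norm : ∀ l v, ‖J l v‖ = ‖v‖
  J_skew : ∀ l, l ≠ 0 → ∀ v w, inner ℝ (J l v) w = -inner ℝ v (J l w)
  J_mul : ∀ a b, a ≠ b → ∃ c, c ≠ 0 ∧ ∃ ε : ℝ, ∀ v w, inner ℝ (J a v) (J b w) = ε * inner ℝ v (J c w)

/-- The infinitesimal action is free at `q`, and the images of the orbit tangent under the `J l`
are mutually orthogonal. -/
structure IsRegularPoint (𝔥 : Submodule ℝ (V →L[ℝ] V)) (J : Fin 4 → V →L[ℝ] V) (q : V) : Prop where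
  inj : ∀ T ∈ 𝔥, T q = 0 → T = 0
  orth : ∀ a b, a ≠ b → ∀ T ∈ 𝔥, ∀ T' ∈ 𝔥, inner ℝ (J a (T q)) (J b (T' q)) = (0 : ℝ)

section Pairing

variable {H : Type*} [NormedAddCommGroup H] [NormedSpace ℝ H] (ι : H →L[ℝ] V →L[ℝ] V)

/-- The infinitesimal action `T ↦ T q`. -/
noncomputable def evalL (q : V) : H →L[ℝ] V := (ContinuousLinearMap.apply ℝ V q).comp ι

@[simp] theorem evalL_apply (q : V) (T : H) : evalL ι q T = ι T q := rfl

variable [FiniteDimensional ℝ V]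

/-- The functional `T ↦ ⟪w, T q⟫` on `H`. -/
noncomputable def pairing (q : V) : V →L[ℝ] H →L[ℝ] ℝ :=
  LinearMap.toContinuousLinearMap
    { toFun := fun w => (innerSL ℝ w).comp (evalL ι q)
      map_add' := fun v w => by ext; simp
      map_smul' := fun r w => by ext; simp }

@[simp] theorem pairing_apply (q w : V) (T : H) : pairing ι q w T = inner ℝ w (ι T q) := rfl

/-- The Gram form of the infinitesimal action. -/
noncomputable def gramL (q : V) : H →L[ℝ] H →L[ℝ] ℝ := (pairing ι q).comp (evalL ι q)

variable [FiniteDimensional ℝ H]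

/-- The Gram form is invertible at a point with free infinitesimal action. -/
theorem exists_equiv_gramL {q : V} (hq : ∀ T, ι T q = 0 → T = 0) :
    ∃ e : H ≃L[ℝ] (H →L[ℝ] ℝ), (e : H →L[ℝ] H →L[ℝ] ℝ) = gramL ι q := by
  have hinj : Function.Injective (gramL ι q : H →ₗ[ℝ] H →L[ℝ] ℝ) := by
    refine (injective_iff_map_eq_zero _).2 fun T hT => hq T ?_
    have := congrArg (fun L : H →L[ℝ] ℝ => L T) hT
    simpa [gramL] using this
  have hdim : Module.finrank ℝ H = Module.finrank ℝ (H →L[ℝ] ℝ) := by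
    rw [← (LinearMap.toContinuousLinearMap (𝕜 := ℝ) (E := H) (F' := ℝ)).finrank_eq]
    exact (Subspace.dual_finrank_eq (K := ℝ) (V := H)).symm
  exact ⟨(LinearEquiv.ofInjectiveOfFinrankEq _ hinj hdim).toContinuousLinearEquiv, rfl⟩

/-- The element of `H` whose value at `q` is the orthogonal projection of `w` to the orbit. -/
noncomputable def vertPart (q w : V) : H := (gramL ι q).inverse (pairing ι q w)

theorem inner_vertPart {q : V} (hq : ∀ T, ι T q = 0 → T = 0) (w : V) (T : H) :
    inner ℝ (ι (vertPart ι q w) q) (ι T q) = inner ℝ w (ι T q) := by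
  obtain ⟨e, he⟩ := exists_equiv_gramL ι hq
  have h1 : gramL ι q (vertPart ι q w) = pairing ι q w := by
    rw [vertPart, ← he, ContinuousLinearMap.inverse_equiv]
    exact e.apply_symm_apply _
  exact congrArg (fun L : H →L[ℝ] ℝ => L T) h1

theorem contDiffOn_vertPart {E : Type*} [NormedAddCommGroup E] [NormedSpace ℝ E] {U : Set E}
    {s w : E → V} (hs : ContDiffOn ℝ ∞ s U) (hw : ContDiffOn ℝ ∞ w U)
    (hfree : ∀ x ∈ U, ∀ T, ι T (s x) = 0 → T = 0) :
    ContDiffOn ℝ ∞ (fun x => vertPart ι (s x) (w x)) U := by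
  have h1 : ContDiffOn ℝ ∞ (fun x => pairing ι (s x) (w x)) U := by
    rw [contDiffOn_clm_apply]
    intro T
    exact hw.inner ℝ ((ι T).contDiff.comp_contDiffOn hs)
  have h2 : ContDiffOn ℝ ∞ (fun x => gramL ι (s x)) U := by
    rw [contDiffOn_clm_apply]
    intro T
    rw [contDiffOn_clm_apply]
    intro T'
    exact ((ι T).contDiff.comp_contDiffOn hs).inner ℝ ((ι T').contDiff.comp_contDiffOn hs)
  have h3 : ContDiffOn ℝ ∞ (fun x => (gramL ι (s x)).inverse) U := by
    have : CompleteSpace H := FiniteDimensional.complete ℝ H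
    intro x hx
    obtain ⟨e, he⟩ := exists_equiv_gramL ι (hfree x hx)
    have := contDiffAt_map_inverse (n := ∞) e
    rw [he] at this
    exact this.comp_contDiffWithinAt x (h2 x hx)
  exact h3.clm_apply h1

end Pairing

/-- Linear coordinates on a finite-dimensional space of operators. -/
noncomputable def coordL [FiniteDimensional ℝ V] (𝔥 : Submodule ℝ (V →L[ℝ] V)) :
    (Fin (Module.finrank ℝ 𝔥) → ℝ) →L[ℝ] V →L[ℝ] V :=
  LinearMap.toContinuousLinearMap
    (𝔥.subtype ∘ₗ (Module.finBasis ℝ 𝔥).equivFun.symm.toLinearMap)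

theorem coordL_mem [FiniteDimensional ℝ V] (𝔥 : Submodule ℝ (V →L[ℝ] V)) (a) :
    coordL 𝔥 a ∈ 𝔥 := ((Module.finBasis ℝ 𝔥).equivFun.symm a).2

theorem coordL_injective [FiniteDimensional ℝ V] (𝔥 : Submodule ℝ (V →L[ℝ] V)) :
    Function.Injective (coordL 𝔥) := fun _ _ h =>
  (Module.finBasis ℝ 𝔥).equivFun.symm.injective (Subtype.ext h)

theorem exists_coordL_eq [FiniteDimensional ℝ V] (𝔥 : Submodule ℝ (V →L[ℝ] V)) {T : V →L[ℝ] V}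
    (hT : T ∈ 𝔥) : ∃ a, coordL 𝔥 a = T :=
  ⟨(Module.finBasis ℝ 𝔥).equivFun ⟨T, hT⟩, congrArg Subtype.val
    ((Module.finBasis ℝ 𝔥).equivFun.symm_apply_apply ⟨T, hT⟩)⟩

variable [FiniteDimensional ℝ V] {n : ℕ}

/-- A smooth slice for the infinitesimal action of `𝔥`, tangent to a level set of the moment map. -/
structure IsSlice (𝔥 : Submodule ℝ (V →L[ℝ] V)) (J : Fin 4 → V →L[ℝ] V)
    (U : Set 𝔼 n) (s : 𝔼 n → V) : Prop where
  isOpen : IsOpen U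
  smooth : ContDiffOn ℝ ∞ s U
  regular : ∀ x ∈ U, IsRegularPoint 𝔥 J (s x)
  tangent : ∀ x ∈ U, ∀ u, ∀ l, l ≠ 0 → ∀ T ∈ 𝔥, inner ℝ (fderiv ℝ s x u) (J l (T (s x))) = (0 : ℝ)
  transverse : ∀ x ∈ U, ∀ u, ∀ T ∈ 𝔥, fderiv ℝ s x u = T (s x) → u = 0
  finrank_eq : n + 4 * Module.finrank ℝ 𝔥 = Module.finrank ℝ V

/-- The connection form of the slice `s`. -/
noncomputable def conn (𝔥 : Submodule ℝ (V →L[ℝ] V)) (s : 𝔼 n → V)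
    (u x : 𝔼 n) : V →L[ℝ] V :=
  coordL 𝔥 (vertPart (coordL 𝔥) (s x) (fderiv ℝ s x u))

theorem conn_mem (𝔥 : Submodule ℝ (V →L[ℝ] V)) (s : 𝔼 n → V) (u x : 𝔼 n) : conn 𝔥 s u x ∈ 𝔥 :=
  coordL_mem _ _

/-- The horizontal frame of the slice `s`. -/
noncomputable def hframe (𝔥 : Submodule ℝ (V →L[ℝ] V)) (s : 𝔼 n → V)
    (i : Fin n) : 𝔼 n → V :=
  covD (conn 𝔥 s) (EuclideanSpace.single i 1) s

theorem linExt_hframe (𝔥 : Submodule ℝ (V →L[ℝ] V)) (s : 𝔼 n → V) (u x : 𝔼 n) :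
    linExt (fun i => hframe 𝔥 s i x) u = covD (conn 𝔥 s) u s x := by
  let L : 𝔼 n →ₗ[ℝ] V :=
    { toFun := fun u => covD (conn 𝔥 s) u s x
      map_add' := fun u v => by simp [covD, conn, vertPart]; abel
      map_smul' := fun r u => by simp [covD, conn, vertPart, smul_sub] }
  exact (eq_linExt L u).symm

namespace IsSlice

variable {𝔥 : Submodule ℝ (V →L[ℝ] V)} {J : Fin 4 → V →L[ℝ] V}
  {U : Set 𝔼 n} {s : 𝔼 n → V}
  (hJ : IsQuaternionic 𝔥 J) (h : IsSlice 𝔥 J U s)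

include h

omit [FiniteDimensional ℝ V] in
theorem contDiffOn_fderiv (u : 𝔼 n) : ContDiffOn ℝ ∞ (fun x => fderiv ℝ s x u) U :=
  (h.smooth.fderiv_of_isOpen h.isOpen (by norm_cast)).clm_apply contDiffOn_const

theorem coordL_free {x : 𝔼 n} (hx : x ∈ U) (T) (hT : coordL 𝔥 T (s x) = 0) : T = 0 :=
  coordL_injective 𝔥 (by rw [map_zero]; exact (h.regular x hx).inj _ (coordL_mem 𝔥 T) hT)

theorem contDiffOn_vert (u : 𝔼 n) :
    ContDiffOn ℝ ∞ (fun x => vertPart (coordL 𝔥) (s x) (fderiv ℝ s x u)) U :=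
  contDiffOn_vertPart _ h.smooth (h.contDiffOn_fderiv u) fun _ hx => h.coordL_free hx

theorem contDiffOn_conn (u : 𝔼 n) : ContDiffOn ℝ ∞ (conn 𝔥 s u) U :=
  (coordL 𝔥).contDiff.comp_contDiffOn (h.contDiffOn_vert u)

theorem contDiffOn_hframe (i : Fin n) : ContDiffOn ℝ ∞ (hframe 𝔥 s i) U :=
  (h.contDiffOn_fderiv _).sub ((h.contDiffOn_conn _).clm_apply h.smooth)

variable {x : 𝔼 n} (hx : x ∈ U)

include hx

theorem inner_covD_orbit (u : 𝔼 n) {T : V →L[ℝ] V} (hT : T ∈ 𝔥) :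
    inner ℝ (covD (conn 𝔥 s) u s x) (T (s x)) = (0 : ℝ) := by
  obtain ⟨a, rfl⟩ := exists_coordL_eq 𝔥 hT
  rw [covD, inner_sub_left, conn, inner_vertPart _ (h.coordL_free hx) _ a, sub_self]

include hJ in
theorem inner_covD_normal (u : 𝔼 n) (l : Fin 4) {T : V →L[ℝ] V} (hT : T ∈ 𝔥) :
    inner ℝ (covD (conn 𝔥 s) u s x) (J l (T (s x))) = (0 : ℝ) := by
  by_cases hl : l = 0
  · subst hl
    rw [hJ.J_zero]
    exact h.inner_covD_orbit hx u hT
  · rw [covD, inner_sub_left, h.tangent x hx u l hl T hT, zero_sub, neg_eq_zero]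
    have := (h.regular x hx).orth 0 l (Ne.symm hl) _
      (conn_mem 𝔥 s u x) T hT
    rwa [hJ.J_zero] at this

theorem curvF_mem (hJ : IsQuaternionic 𝔥 J) (u v : 𝔼 n) : curvF (conn 𝔥 s) u v x ∈ 𝔥 := by
  have key : ∀ u v, fderiv ℝ (conn 𝔥 s v) x u ∈ 𝔥 := by
    intro u v
    have hd : DifferentiableAt ℝ (fun x => vertPart (coordL 𝔥) (s x) (fderiv ℝ s x v)) x :=
      ((h.contDiffOn_vert v).contDiffAt (h.isOpen.mem_nhds hx)).differentiableAt (by simp)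
    have := ((coordL 𝔥).hasFDerivAt.comp x hd.hasFDerivAt).fderiv
    change fderiv ℝ (conn 𝔥 s v) x = _ at this
    rw [this]
    exact coordL_mem _ _
  exact 𝔥.sub_mem (𝔥.sub_mem (key u v) (key v u))
    (hJ.lie _ (conn_mem _ _ _ _) _ (conn_mem _ _ _ _))

theorem covD_eq_zero {u : 𝔼 n} (hu : covD (conn 𝔥 s) u s x = 0) : u = 0 :=
  h.transverse x hx u _ (conn_mem 𝔥 s u x) (sub_eq_zero.1 hu)

theorem covD_hframe_sub (i j : Fin n) :
    covD (conn 𝔥 s) (EuclideanSpace.single i 1) (hframe 𝔥 s j) x -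
      covD (conn 𝔥 s) (EuclideanSpace.single j 1) (hframe 𝔥 s i) x =
    -curvF (conn 𝔥 s) (EuclideanSpace.single i 1) (EuclideanSpace.single j 1) x (s x) :=
  covD_comm h.isOpen hx h.contDiffOn_conn h.smooth _ _

omit hx in
theorem frameMetric (hJ : IsQuaternionic 𝔥 J) {g : 𝔼 n → Matrix (Fin n) (Fin n) ℝ}
    (hg : ∀ x ∈ U, ∀ i j, g x i j = inner ℝ (hframe 𝔥 s i x) (hframe 𝔥 s j x)) :
    FrameMetric g U (conn 𝔥 s) (hframe 𝔥 s) where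
  isOpen := h.isOpen
  smooth_conn := h.contDiffOn_conn
  smooth_frame := h.contDiffOn_hframe
  skew u x _ := hJ.skew _ (conn_mem _ _ _ _)
  metric_eq := hg
  det_ne_zero x hx h0 := by
    obtain ⟨w, hw, hw0⟩ := Matrix.exists_mulVec_eq_zero_iff.2 h0
    apply hw
    have e : inner ℝ (linExt (fun i => hframe 𝔥 s i x) (WithLp.toLp 2 w))
        (linExt (fun i => hframe 𝔥 s i x) (WithLp.toLp 2 w)) = (0 : ℝ) := by
      have h1 : w ⬝ᵥ (g x *ᵥ w) = 0 := by rw [hw0, dotProduct_zero]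
      rw [← h1]
      simp only [linExt_apply, sum_inner, inner_sum, inner_smul_left, inner_smul_right,
        dotProduct, Matrix.mulVec, hg x hx, Finset.mul_sum]
      rw [Finset.sum_comm]
      refine Finset.sum_congr rfl fun i _ => Finset.sum_congr rfl fun j _ => ?_
      simp
      ring
    rw [inner_self_eq_zero, linExt_hframe] at e
    have := h.covD_eq_zero hx e
    simpa using this
  torsion x hx i j k := by
    rw [← sub_eq_zero, ← inner_sub_left, h.covD_hframe_sub hx, inner_neg_left, neg_eq_zero,
      real_inner_comm]
    exact h.inner_covD_orbit hx _ (h.curvF_mem hx hJ _ _)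

theorem inner_covD_hframe (hJ : IsQuaternionic 𝔥 J) (u : 𝔼 n) (j : Fin n) (l : Fin 4)
    {T : V →L[ℝ] V} (hT : T ∈ 𝔥) :
    inner ℝ (covD (conn 𝔥 s) u (hframe 𝔥 s j) x) (J l (T (s x))) =
      -inner ℝ (hframe 𝔥 s j x) (J l (T (covD (conn 𝔥 s) u s x))) := by
  have hsx : DifferentiableAt ℝ s x :=
    (h.smooth.contDiffAt (h.isOpen.mem_nhds hx)).differentiableAt (by simp)
  have hXx : DifferentiableAt ℝ (hframe 𝔥 s j) x :=
    ((h.contDiffOn_hframe j).contDiffAt (h.isOpen.mem_nhds hx)).differentiableAt (by simp)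
  have hJT : HasFDerivAt (fun y => J l (T (s y))) (((J l).comp T).comp (fderiv ℝ s x)) x :=
    ((J l).comp T).hasFDerivAt.comp x hsx.hasFDerivAt
  have h0 : (fun y => inner ℝ (hframe 𝔥 s j y) (J l (T (s y)))) =ᶠ[𝓝 x] fun _ => (0 : ℝ) := by
    filter_upwards [h.isOpen.mem_nhds hx] with y hy using h.inner_covD_normal hJ hy _ l hT
  have h1 := fderiv_inner_eq_covD (u := u) (A := conn 𝔥 s)
    (hJ.skew _ (conn_mem 𝔥 s u x)) hXx hJT.differentiableAt
  rw [h0.fderiv_eq, fderiv_const_apply, _root_.zero_apply] at h1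
  have hc := conn_mem 𝔥 s u x
  have h2 : covD (conn 𝔥 s) u (fun y => J l (T (s y))) x =
      J l (T (covD (conn 𝔥 s) u s x)) +
        J l ((T * conn 𝔥 s u x - conn 𝔥 s u x * T) (s x)) := by
    simp only [covD, hJT.fderiv, ContinuousLinearMap.comp_apply, ← hJ.J_comm _ hc, map_sub,
      _root_.sub_apply, mul_apply_eq_comp]
    abel
  have h3 : inner ℝ (hframe 𝔥 s j x)
      (J l ((T * conn 𝔥 s u x - conn 𝔥 s u x * T) (s x))) = (0 : ℝ) :=
    h.inner_covD_normal hJ hx _ l (hJ.lie _ hT _ hc)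
  rw [h2, inner_add_right, h3] at h1
  linarith

end IsSlice

namespace IsRegularPoint

variable {𝔥 : Submodule ℝ (V →L[ℝ] V)} {J : Fin 4 → V →L[ℝ] V} {q : V}

/-- The map `(T₀, …, T₃) ↦ T₀ q + J₁ T₁ q + J₂ T₂ q + J₃ T₃ q`. -/
noncomputable def orbitSum (𝔥 : Submodule ℝ (V →L[ℝ] V)) (J : Fin 4 → V →L[ℝ] V) (q : V) :
    (Fin 4 → 𝔥) →ₗ[ℝ] V where
  toFun T := ∑ l, J l ((T l : V →L[ℝ] V) q)
  map_add' S T := by simp [Finset.sum_add_distrib]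
  map_smul' r T := by simp [Finset.smul_sum]

omit [FiniteDimensional ℝ V] in
theorem inner_orbitSum (hJ : IsQuaternionic 𝔥 J) (hq : IsRegularPoint 𝔥 J q) (T : Fin 4 → 𝔥) :
    ‖orbitSum 𝔥 J q T‖ ^ 2 = ∑ l, ‖(T l : V →L[ℝ] V) q‖ ^ 2 := by
  rw [← real_inner_self_eq_norm_sq]
  simp only [orbitSum, LinearMap.coe_mk, AddHom.coe_mk, sum_inner, inner_sum]
  refine Finset.sum_congr rfl fun l _ => ?_
  rw [Finset.sum_eq_single l (fun b _ hb => ?_) (by simp), real_inner_self_eq_norm_sq, hJ.J_norm]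
  exact hq.orth _ _ hb _ (T _).2 _ (T _).2

omit [FiniteDimensional ℝ V] in
theorem orbitSum_injective (hJ : IsQuaternionic 𝔥 J) (hq : IsRegularPoint 𝔥 J q) :
    Function.Injective (orbitSum 𝔥 J q) := by
  rw [← LinearMap.ker_eq_bot, LinearMap.ker_eq_bot']
  intro T hT
  have h1 := inner_orbitSum hJ hq T
  rw [hT, norm_zero, zero_pow two_ne_zero, eq_comm,
    Finset.sum_eq_zero_iff_of_nonneg fun l _ => sq_nonneg _] at h1
  funext l
  have := h1 l (Finset.mem_univ l)
  exact Subtype.ext (hq.inj _ (T l).2 (by simpa using this))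

theorem finrank_range_orbitSum (hJ : IsQuaternionic 𝔥 J) (hq : IsRegularPoint 𝔥 J q) :
    Module.finrank ℝ (LinearMap.range (orbitSum 𝔥 J q)) = 4 * Module.finrank ℝ 𝔥 := by
  rw [LinearMap.finrank_range_of_inj (orbitSum_injective hJ hq), Module.finrank_pi_fintype]
  simp

omit [FiniteDimensional ℝ V] in
theorem norm_orbitSum_le (hJ : IsQuaternionic 𝔥 J) (hq : IsRegularPoint 𝔥 J q) {δ C : ℝ}
    (hδ : 0 < δ) (hC : 0 ≤ C) (hb : ∀ T ∈ 𝔥, δ * ‖T‖ ≤ ‖T q‖) (T : Fin 4 → 𝔥)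
    (hT : ∀ l, ∀ S ∈ 𝔥, |inner ℝ (orbitSum 𝔥 J q T) (J l (S q))| ≤ C * ‖S‖) :
    ‖orbitSum 𝔥 J q T‖ ≤ 4 / δ * C := by
  set w := orbitSum 𝔥 J q T with hw
  have h1 : ‖w‖ ^ 2 = ∑ l, inner ℝ w (J l ((T l : V →L[ℝ] V) q)) := by
    rw [← real_inner_self_eq_norm_sq]
    conv_lhs => rw [hw, orbitSum, LinearMap.coe_mk, AddHom.coe_mk, inner_sum]
    rfl
  have h2 : ∀ l, ‖(T l : V →L[ℝ] V) q‖ ≤ ‖w‖ := by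
    intro l
    refine (sq_le_sq₀ (norm_nonneg _) (norm_nonneg _)).1 ?_
    rw [inner_orbitSum hJ hq]
    exact Finset.single_le_sum (f := fun l => ‖(T l : V →L[ℝ] V) q‖ ^ 2)
      (fun l _ => sq_nonneg _) (Finset.mem_univ l)
  have h3 : ‖w‖ ^ 2 ≤ ∑ _l : Fin 4, C * (‖w‖ / δ) := by
    rw [h1]
    refine Finset.sum_le_sum fun l _ => (le_abs_self _).trans ((hT l _ (T l).2).trans ?_)
    gcongr
    rw [le_div_iff₀ hδ, mul_comm]
    exact (hb _ (T l).2).trans (h2 l)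
  rcases (norm_nonneg w).eq_or_lt with h0 | h0
  · rw [← h0]; positivity
  · rw [Finset.sum_const, Finset.card_univ, Fintype.card_fin, nsmul_eq_mul] at h3
    have : ‖w‖ * ‖w‖ ≤ (4 / δ * C) * ‖w‖ := by
      calc ‖w‖ * ‖w‖ = ‖w‖ ^ 2 := by ring
        _ ≤ _ := h3
        _ = _ := by push_cast; ring
    exact le_of_mul_le_mul_right this h0

end IsRegularPoint

namespace IsSlice

variable {𝔥 : Submodule ℝ (V →L[ℝ] V)} {J : Fin 4 → V →L[ℝ] V}
  {U : Set 𝔼 n} {s : 𝔼 n → V}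
  (hJ : IsQuaternionic 𝔥 J) (h : IsSlice 𝔥 J U s)
  {x : 𝔼 n} (hx : x ∈ U)

include hJ h hx

open IsRegularPoint in
theorem exists_orbitSum_eq {w : V} (hw : ∀ i, inner ℝ w (hframe 𝔥 s i x) = (0 : ℝ)) :
    ∃ T, orbitSum 𝔥 J (s x) T = w := by
  have hq := h.regular x hx
  let X : 𝔼 n →ₗ[ℝ] V := linExt fun i => hframe 𝔥 s i x
  have hX : Function.Injective X := by
    rw [← LinearMap.ker_eq_bot, LinearMap.ker_eq_bot']
    intro u hu
    exact h.covD_eq_zero hx (by rw [← linExt_hframe]; exact hu)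
  have hle : LinearMap.range (orbitSum 𝔥 J (s x)) ≤ (LinearMap.range X)ᗮ := by
    rintro _ ⟨T, rfl⟩
    rw [Submodule.mem_orthogonal]
    rintro _ ⟨u, rfl⟩
    simp only [X, linExt_hframe, orbitSum, LinearMap.coe_mk, AddHom.coe_mk, inner_sum]
    exact Finset.sum_eq_zero fun l _ => h.inner_covD_normal hJ hx u l (T l).2
  have hfin : Module.finrank ℝ (LinearMap.range (orbitSum 𝔥 J (s x))) =
      Module.finrank ℝ (LinearMap.range X)ᗮ := by
    have h1 := (LinearMap.range X).finrank_add_finrank_orthogonal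
    rw [LinearMap.finrank_range_of_inj hX, finrank_euclideanSpace_fin] at h1
    rw [finrank_range_orbitSum hJ hq]
    have := h.finrank_eq
    omega
  have heq := Submodule.eq_of_le_of_finrank_eq hle hfin
  have hwm : w ∈ (LinearMap.range X)ᗮ := by
    rw [Submodule.mem_orthogonal']
    rintro _ ⟨u, rfl⟩
    simp only [X, linExt_apply, inner_sum, inner_smul_right, hw, mul_zero, Finset.sum_const_zero]
  rw [← heq] at hwm
  exact hwm

variable {g : 𝔼 n → Matrix (Fin n) (Fin n) ℝ}
  (hg : ∀ x ∈ U, ∀ i j, g x i j = inner ℝ (hframe 𝔥 s i x) (hframe 𝔥 s j x))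
  {δ : ℝ} (hδ : 0 < δ) (hb : ∀ T ∈ 𝔥, δ * ‖T‖ ≤ ‖T (s x)‖)

include hg hδ hb

theorem norm_secondForm_le (u v : 𝔼 n) :
    ‖bilinExt (secondForm g (conn 𝔥 s) (hframe 𝔥 s) x) u v‖ ≤
      4 / δ * (‖linExt (fun i => hframe 𝔥 s i x) u‖ * ‖linExt (fun i => hframe 𝔥 s i x) v‖) := by
  have hm := h.frameMetric hJ hg
  set X := linExt (fun i => hframe 𝔥 s i x) with hX
  have horth : ∀ i, inner ℝ (bilinExt (secondForm g (conn 𝔥 s) (hframe 𝔥 s) x) u v)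
      (hframe 𝔥 s i x) = (0 : ℝ) := by
    intro i
    simp [bilinExt_apply, sum_inner, inner_smul_left, hm.inner_secondForm hx]
  obtain ⟨T, hT⟩ := h.exists_orbitSum_eq hJ hx horth
  rw [← hT]
  refine IsRegularPoint.norm_orbitSum_le hJ (h.regular x hx) hδ (by positivity) hb T ?_
  intro l S hS
  have key : inner ℝ (bilinExt (secondForm g (conn 𝔥 s) (hframe 𝔥 s) x) u v) (J l (S (s x))) =
      -inner ℝ (X v) (J l (S (X u))) := by
    have e : ∀ i j, inner ℝ (secondForm g (conn 𝔥 s) (hframe 𝔥 s) x i j) (J l (S (s x))) =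
        -inner ℝ (hframe 𝔥 s j x) (J l (S (hframe 𝔥 s i x))) := by
      intro i j
      have z : inner ℝ (∑ m, christoffel g m i j x • hframe 𝔥 s m x) (J l (S (s x))) = (0 : ℝ) := by
        rw [sum_inner]
        refine Finset.sum_eq_zero fun m _ => ?_
        rw [inner_smul_left]
        have := h.inner_covD_normal hJ hx (EuclideanSpace.single m 1) l hS
        rw [hframe, this, mul_zero]
      rw [secondForm, inner_sub_left, z, sub_zero, h.inner_covD_hframe hx hJ _ j l hS]
      rfl
    simp only [bilinExt_apply, sum_inner, inner_smul_left, e, hX, linExt_apply, map_sum, inner_sum,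
      map_smul, inner_smul_right, ← Finset.sum_neg_distrib, Finset.mul_sum]
    refine Finset.sum_congr rfl fun i _ => Finset.sum_congr rfl fun j _ => ?_
    simp
    ring
  rw [hT, key, abs_neg]
  calc |inner ℝ (X v) (J l (S (X u)))| ≤ ‖X v‖ * ‖J l (S (X u))‖ := abs_real_inner_le_norm _ _
    _ ≤ ‖X v‖ * (‖S‖ * ‖X u‖) := by
      rw [hJ.J_norm]
      gcongr
      exact S.le_opNorm _
    _ = _ := by ring

theorem norm_curvF_le (u v : 𝔼 n) :
    ‖bilinExt (fun i j => curvF (conn 𝔥 s) (EuclideanSpace.single i 1)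
        (EuclideanSpace.single j 1) x) u v‖ ≤
      8 / δ ^ 2 *
        (‖linExt (fun i => hframe 𝔥 s i x) u‖ * ‖linExt (fun i => hframe 𝔥 s i x) v‖) := by
  have hm := h.frameMetric hJ hg
  set X := linExt (fun i => hframe 𝔥 s i x) with hX
  set F := bilinExt (fun i j => curvF (conn 𝔥 s) (EuclideanSpace.single i 1)
        (EuclideanSpace.single j 1) x) with hF
  set Q := bilinExt (secondForm g (conn 𝔥 s) (hframe 𝔥 s) x) with hQ
  have hmem : F u v ∈ 𝔥 := by
    rw [hF, bilinExt_apply]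
    exact 𝔥.sum_mem fun i _ => 𝔥.sum_mem fun j _ => 𝔥.smul_mem _ (h.curvF_mem hx hJ _ _)
  have hval : F u v (s x) = Q v u - Q u v := by
    have e : ∀ i j, curvF (conn 𝔥 s) (EuclideanSpace.single i 1) (EuclideanSpace.single j 1) x (s x)
        = secondForm g (conn 𝔥 s) (hframe 𝔥 s) x j i -
          secondForm g (conn 𝔥 s) (hframe 𝔥 s) x i j := by
      intro i j
      have hc : ∀ m, christoffel g m i j x = christoffel g m j i x := by
        intro m
        rw [hm.christoffel_eq hx, hm.christoffel_eq hx]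
        exact Finset.sum_congr rfl fun k _ => by rw [hm.torsion x hx i j k]
      rw [← neg_inj, ← h.covD_hframe_sub hx, secondForm, secondForm]
      simp only [hc]
      abel
    simp only [hF, hQ, bilinExt_apply, _root_.sum_apply, _root_.smul_apply, e, smul_sub,
      Finset.sum_sub_distrib]
    congr 1
    rw [Finset.sum_comm]
    exact Finset.sum_congr rfl fun i _ => Finset.sum_congr rfl fun j _ => by rw [mul_comm]
  have h1 : δ * ‖F u v‖ ≤ 8 / δ * (‖X u‖ * ‖X v‖) := by
    refine (hb _ hmem).trans ?_
    rw [hval]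
    refine (norm_sub_le _ _).trans ?_
    have a := h.norm_secondForm_le hJ hx hg hδ hb v u
    have b := h.norm_secondForm_le hJ hx hg hδ hb u v
    calc _ ≤ _ := add_le_add a b
      _ = _ := by ring
  rw [← mul_le_mul_iff_right₀ hδ]
  refine h1.trans (le_of_eq ?_)
  field_simp

/-- The sectional curvatures of the quotient metric are bounded in terms of a lower bound of the
infinitesimal action. -/
theorem abs_sectionalCurvature_le {u v : 𝔼 n} (huv : LinearIndependent ℝ ![u, v]) :
    |sectionalCurvature g x u v| ≤ 40 / δ ^ 2 := by
  have hm := h.frameMetric hJ hg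
  have key := abs_curvature_quotient_le (linExt fun i => hframe 𝔥 s i x)
    (fun u hu => h.covD_eq_zero hx (by rw [← linExt_hframe]; exact hu))
    (bilinExt fun i j => curvF (conn 𝔥 s) (EuclideanSpace.single i 1) (EuclideanSpace.single j 1) x)
    (bilinExt (secondForm g (conn 𝔥 s) (hframe 𝔥 s) x)) ?_ ?_ (h.norm_curvF_le hJ hx hg hδ hb)
    (h.norm_secondForm_le hJ hx hg hδ hb) huv
  · rw [sectionalCurvature, hm.metricForm_riemannVec_eq hx, hm.metricForm_eq hx, hm.metricForm_eq hx,
      hm.metricForm_eq hx]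
    refine key.trans (le_of_eq ?_)
    field_simp
    norm_num
  · intro u v
    have e : ∀ i j : Fin n,
        curvF (conn 𝔥 s) (EuclideanSpace.single i 1) (EuclideanSpace.single j 1) x =
        -curvF (conn 𝔥 s) (EuclideanSpace.single j 1) (EuclideanSpace.single i 1) x := by
      intro i j
      simp only [curvF]
      abel
    rw [bilinExt_apply, bilinExt_apply, Finset.sum_comm, ← Finset.sum_neg_distrib]
    refine Finset.sum_congr rfl fun i _ => ?_
    rw [← Finset.sum_neg_distrib]
    refine Finset.sum_congr rfl fun j _ => ?_
    rw [e, smul_neg, mul_comm]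
  · intro u v a b
    refine hJ.skew _ ?_ a b
    rw [bilinExt_apply]
    exact 𝔥.sum_mem fun i _ => 𝔥.sum_mem fun j _ => 𝔥.smul_mem _ (h.curvF_mem hx hJ _ _)

end IsSlice

end Slice

/-! ## Existence of slices -/

section SliceExistence

variable {V : Type*} [NormedAddCommGroup V] [InnerProductSpace ℝ V] [FiniteDimensional ℝ V]

/-- A closed group `S` of isometries of `V` with Lie algebra `𝔥`. -/
structure IsOperatorGroup (S : Set (V →L[ℝ] V)) (𝔥 : Submodule ℝ (V →L[ℝ] V)) : Prop where
  isClosed : IsClosed S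
  one_mem : 1 ∈ S
  mul_mem : ∀ x ∈ S, ∀ y ∈ S, x * y ∈ S
  inv_mem : ∀ x ∈ S, ∀ y, x * y = 1 → y ∈ S
  mem_lie : ∀ X, X ∈ 𝔥 ↔ ∀ t : ℝ, NormedSpace.exp (t • X) ∈ S
  isometry : ∀ T ∈ S, ∀ v, ‖T v‖ = ‖v‖

namespace IsOperatorGroup

variable {S : Set (V →L[ℝ] V)} {𝔥 : Submodule ℝ (V →L[ℝ] V)} (hS : IsOperatorGroup S 𝔥)

include hS

omit [FiniteDimensional ℝ V] in
theorem exp_mem {X : V →L[ℝ] V} (hX : X ∈ 𝔥) : NormedSpace.exp X ∈ S := by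
  simpa using (hS.mem_lie X).1 hX 1

theorem isCompact : IsCompact S := by
  have : ProperSpace (V →L[ℝ] V) := FiniteDimensional.proper ℝ _
  refine (isCompact_closedBall (0 : V →L[ℝ] V) 1).of_isClosed_subset hS.isClosed fun T hT => ?_
  rw [mem_closedBall_zero_iff]
  exact T.opNorm_le_bound zero_le_one fun v => by rw [hS.isometry T hT, one_mul]

/-- Group elements moving a point with trivial stabilizer only a little are exponentials of small
elements of the Lie algebra. -/
theorem exists_exp_of_norm_sub_lt {q : V} (hfree : ∀ T ∈ S, T q = q → T = 1) {ε : ℝ} (hε : 0 < ε) :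
    ∃ η > 0, ∀ T ∈ S, ‖T q - q‖ < η → ∃ X ∈ 𝔥, ‖X‖ < ε ∧ NormedSpace.exp X = T := by
  obtain ⟨r, hr, hball⟩ := Metric.eventually_nhds_iff_ball.1 (eventually_exists_exp_eq hS.isClosed
    hS.one_mem hS.mul_mem hS.inv_mem 𝔥 hS.mem_lie hε)
  have hK : IsCompact (S \ Metric.ball 1 r) := hS.isCompact.diff Metric.isOpen_ball
  have hcont : ContinuousOn (fun T : V →L[ℝ] V => ‖T q - q‖) (S \ Metric.ball 1 r) := by fun_prop
  obtain ⟨η, hη, hle⟩ := hK.exists_forall_le' hcont (a := 0) fun T hT => by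
    rw [norm_pos_iff, sub_ne_zero]
    intro h
    exact hT.2 (by rw [hfree T hT.1 h]; exact Metric.mem_ball_self hr)
  refine ⟨η, hη, fun T hT hlt => hball T ?_ hT⟩
  by_contra hTr
  exact absurd (hle T ⟨hT, hTr⟩) (not_le.2 hlt)

end IsOperatorGroup

variable {n : ℕ} {W : Type*} [NormedAddCommGroup W] [NormedSpace ℝ W] [FiniteDimensional ℝ W]

theorem exists_slice {S : Set (V →L[ℝ] V)} {𝔥 : Submodule ℝ (V →L[ℝ] V)}
    (hS : IsOperatorGroup S 𝔥) {m : V → W} (hm : ContDiff ℝ ω m)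
    (hmS : ∀ T ∈ S, ∀ q, m q = 0 → m (T q) = 0)
    {q₀ : V} (hq₀ : m q₀ = 0) (hfree : ∀ T ∈ S, T q₀ = q₀ → T = 1)
    {D : V →L[ℝ] W} (hD : HasFDerivAt m D q₀) (hDsurj : Function.Surjective D)
    (hD𝔥 : ∀ T ∈ 𝔥, D (T q₀) = 0)
    (H : 𝔼 n →L[ℝ] V) (hDH : ∀ x, D (H x) = 0)
    (hspan : ∀ v, D v = 0 → ∃ T ∈ 𝔥, ∃ x, v = T q₀ + H x)
    (hindep : ∀ T ∈ 𝔥, ∀ x, T q₀ + H x = 0 → T = 0 ∧ x = 0) :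
    ∃ (U : Set 𝔼 n) (s : 𝔼 n → V),
      IsOpen U ∧ 0 ∈ U ∧ s 0 = q₀ ∧ ContDiffOn ℝ ∞ s U ∧ (∀ x ∈ U, m (s x) = 0) ∧
      (∀ x ∈ U, ∀ u, ∀ T ∈ 𝔥, fderiv ℝ s x u = T (s x) → u = 0) ∧
      (∀ x ∈ U, ∀ y ∈ U, ∀ T ∈ S, T (s x) = s y → x = y) ∧
      (∀ x ∈ U, ∀ N ∈ 𝓝 x, ∀ᶠ q in 𝓝 (s x), m q = 0 → ∃ T ∈ S, ∃ y ∈ N, q = T (s y)) := by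
  have : CompleteSpace V := FiniteDimensional.complete ℝ V
  -- linear algebra at the base point
  let Λ : (Fin (Module.finrank ℝ 𝔥) → ℝ) × 𝔼 n →L[ℝ] V :=
    (evalL (coordL 𝔥) q₀).comp (ContinuousLinearMap.fst ℝ _ _) +
      H.comp (ContinuousLinearMap.snd ℝ _ _)
  have hΛ : ∀ p, Λ p = coordL 𝔥 p.1 q₀ + H p.2 := fun p => rfl
  have hΛinj : LinearMap.ker (Λ : (Fin (Module.finrank ℝ 𝔥) → ℝ) × 𝔼 n →ₗ[ℝ] V) = ⊥ := by
    refine LinearMap.ker_eq_bot'.2 fun p hp => ?_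
    obtain ⟨h1, h2⟩ := hindep _ (coordL_mem 𝔥 p.1) p.2 (by rw [← hΛ]; exact hp)
    exact Prod.ext (coordL_injective 𝔥 (by rw [h1]; exact (map_zero _).symm)) h2
  obtain ⟨l₀, hl₀⟩ := LinearMap.exists_leftInverse_of_injective
    (Λ : (Fin (Module.finrank ℝ 𝔥) → ℝ) × 𝔼 n →ₗ[ℝ] V) hΛinj
  let l : V →L[ℝ] (Fin (Module.finrank ℝ 𝔥) → ℝ) × 𝔼 n := LinearMap.toContinuousLinearMap l₀
  have hl : ∀ p, l (Λ p) = p := fun p => LinearMap.congr_fun hl₀ p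
  let α : V →L[ℝ] V →L[ℝ] V := (coordL 𝔥).comp ((ContinuousLinearMap.fst ℝ _ _).comp l)
  let η : V →L[ℝ] 𝔼 n := (ContinuousLinearMap.snd ℝ _ _).comp l
  have hα𝔥 : ∀ v, α v ∈ 𝔥 := fun v => coordL_mem 𝔥 _
  have hα : ∀ T ∈ 𝔥, ∀ x, α (T q₀ + H x) = T := by
    intro T hT x
    obtain ⟨a, rfl⟩ := exists_coordL_eq 𝔥 hT
    change coordL 𝔥 (l (Λ (a, x))).1 = _
    rw [hl]
  have hη : ∀ T ∈ 𝔥, ∀ x, η (T q₀ + H x) = x := by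
    intro T hT x
    obtain ⟨a, rfl⟩ := exists_coordL_eq 𝔥 hT
    change (l (Λ (a, x))).2 = _
    rw [hl]
  have hαH : ∀ x, α (H x) = 0 := fun x => by simpa using hα 0 (zero_mem _) x
  have hηH : ∀ x, η (H x) = x := fun x => by simpa using hη 0 (zero_mem _) x
  have hker : ∀ v, D v = 0 → v = α v q₀ + H (η v) := by
    intro v hv
    obtain ⟨T, hT, x, rfl⟩ := hspan v hv
    rw [hα T hT, hη T hT]
  -- a chart of `V` straightening the level set
  obtain ⟨R₀, hR₀⟩ := LinearMap.exists_rightInverse_of_surjective (D : V →ₗ[ℝ] W)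
    (LinearMap.range_eq_top.2 hDsurj)
  let R : W →L[ℝ] V := LinearMap.toContinuousLinearMap R₀
  have hDR : ∀ w, D (R w) = w := fun w => LinearMap.congr_fun hR₀ w
  let Ψ : V → V := fun q => q - q₀ - R (D (q - q₀)) + R (m q)
  have hDΨ : ∀ q, D (Ψ q) = m q := fun q => by simp [Ψ, hDR]
  have hΨ0 : Ψ q₀ = 0 := by simp [Ψ, hq₀]
  have hΨω : ContDiff ℝ ω Ψ := by
    have h1 : ContDiff ℝ ω fun q : V => q - q₀ := contDiff_id.sub contDiff_const
    exact (h1.sub (R.contDiff.comp (D.contDiff.comp h1))).add (R.contDiff.comp hm)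
  have hΨ' : HasFDerivAt Ψ ((ContinuousLinearEquiv.refl ℝ V : V ≃L[ℝ] V) : V →L[ℝ] V) q₀ := by
    have h1 : HasFDerivAt (fun q : V => q - q₀) (ContinuousLinearMap.id ℝ V) q₀ :=
      (hasFDerivAt_id q₀).sub_const q₀
    have h2 := (h1.sub (R.hasFDerivAt.comp q₀ (D.hasFDerivAt.comp q₀ h1))).add
      (R.hasFDerivAt.comp q₀ hD)
    refine h2.congr_fderiv ?_
    ext v
    simp
  have hstr := hΨω.contDiffAt.hasStrictFDerivAt' hΨ' (by simp)
  let χ : V → V := hstr.localInverse Ψ _ q₀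
  have hχω : ContDiffAt ℝ ω χ 0 := by
    have := hΨω.contDiffAt.to_localInverse hΨ' (n := ω) (by simp)
    rw [hΨ0] at this
    exact this
  have hχ0 : χ 0 = q₀ := by
    have := hstr.localInverse_apply_image
    rwa [hΨ0] at this
  have hχ' : HasStrictFDerivAt χ (ContinuousLinearMap.id ℝ V) 0 := by
    have := hstr.to_localInverse
    rw [hΨ0] at this
    exact this
  have hmχ : ∀ᶠ v in 𝓝 (0 : V), m (χ v) = D v := by
    have := hstr.eventually_right_inverse
    rw [hΨ0] at this
    filter_upwards [this] with v hv
    rw [← hDΨ]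
    exact congrArg D hv
  -- a chart of `V` straightening the orbits as well
  let κ : V →L[ℝ] V := (ContinuousLinearMap.apply ℝ V q₀).comp α
  have hκ : ∀ v, κ v = α v q₀ := fun v => rfl
  let Ξ : V → V := fun v => NormedSpace.exp (α v) (χ (v - κ v))
  have hΞ' : HasStrictFDerivAt Ξ
      ((ContinuousLinearEquiv.refl ℝ V : V ≃L[ℝ] V) : V →L[ℝ] V) 0 := by
    have h1 : HasStrictFDerivAt (fun v => NormedSpace.exp (α v)) α 0 := by
      have := HasStrictFDerivAt.comp (g := NormedSpace.exp) (f := α) (x := (0 : V)) (g' := 1)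
        (by rw [map_zero]; exact hasStrictFDerivAt_exp_zero) α.hasStrictFDerivAt
      exact this
    have h2 : HasStrictFDerivAt (fun v => χ (v - κ v)) (ContinuousLinearMap.id ℝ V - κ) 0 := by
      have := HasStrictFDerivAt.comp (g := χ) (f := (ContinuousLinearMap.id ℝ V - κ : V →L[ℝ] V))
        (x := (0 : V)) (g' := ContinuousLinearMap.id ℝ V) (by rw [map_zero]; exact hχ')
        (ContinuousLinearMap.id ℝ V - κ).hasStrictFDerivAt
      exact this
    refine (h1.clm_apply h2).congr_fderiv ?_
    ext v
    simp [hχ0, hκ]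
  let e := hΞ'.toOpenPartialHomeomorph Ξ
  have he : ∀ v, e v = Ξ v := fun v => rfl
  have he0 : (0 : V) ∈ e.source := hΞ'.mem_toOpenPartialHomeomorph_source
  have hexp0 : ∀ x, Ξ (H x) = χ (H x) := by
    intro x
    simp only [Ξ, hκ, hαH, NormedSpace.exp_zero]
    simp
  obtain ⟨ρ, hρ, hρball⟩ := Metric.isOpen_iff.1 e.open_source 0 he0
  -- the slice
  let s : 𝔼 n → V := fun x => χ (H x)
  have hs0 : s 0 = q₀ := by simp [s, hχ0]
  have hH0 : Tendsto H (𝓝 0) (𝓝 0) := by simpa using H.continuous.tendsto 0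
  have hsω : ContDiffAt ℝ ω s 0 :=
    ContDiffAt.comp 0 (by rw [map_zero]; exact hχω) H.contDiff.contDiffAt
  have hscont : Tendsto s (𝓝 0) (𝓝 q₀) := by
    have := hsω.continuousAt.tendsto
    rwa [hs0] at this
  have hs' : fderiv ℝ s 0 = H := by
    have := HasFDerivAt.comp (g := χ) (f := H) (0 : 𝔼 n) (g' := ContinuousLinearMap.id ℝ V)
      (by rw [map_zero]; exact hχ'.hasFDerivAt) H.hasFDerivAt
    rw [ContinuousLinearMap.id_comp] at this
    exact this.fderiv
  have hunit : ∀ᶠ x in 𝓝 (0 : 𝔼 n), IsUnit (l.comp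
      ((evalL (coordL 𝔥) (s x)).comp (ContinuousLinearMap.fst ℝ _ _) +
        (fderiv ℝ s x).comp (ContinuousLinearMap.snd ℝ _ _))) := by
    have hc : ContinuousAt (fun x => l.comp
        ((evalL (coordL 𝔥) (s x)).comp (ContinuousLinearMap.fst ℝ _ _) +
          (fderiv ℝ s x).comp (ContinuousLinearMap.snd ℝ _ _))) 0 := by
      have c1 : ContinuousAt (fun x => evalL (coordL 𝔥) (s x)) 0 :=
        (((ContinuousLinearMap.apply ℝ V).continuous.continuousAt (x := s 0)).comp
          hsω.continuousAt).clm_comp continuousAt_const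
      have c2 : ContinuousAt (fderiv ℝ s) 0 :=
        (hsω.fderiv_right (m := ω) (by simp)).continuousAt
      exact continuousAt_const.clm_comp ((c1.clm_comp continuousAt_const).add
        (c2.clm_comp continuousAt_const))
    refine hc.eventually (Units.isOpen.mem_nhds ?_)
    change IsUnit (l.comp ((evalL (coordL 𝔥) (s 0)).comp (ContinuousLinearMap.fst ℝ _ _) +
      (fderiv ℝ s 0).comp (ContinuousLinearMap.snd ℝ _ _)))
    rw [hs0, hs']
    have : l.comp Λ = 1 := by
      exact ContinuousLinearMap.ext hl
    change IsUnit (l.comp Λ)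
    rw [this]
    exact isUnit_one
  obtain ⟨δ, hδ, hδexp⟩ := hS.exists_exp_of_norm_sub_lt hfree
    (ε := ρ / 2 / (‖q₀‖ + 1)) (by positivity)
  have hnear : ∀ᶠ x in 𝓝 (0 : 𝔼 n), ‖s x - q₀‖ < δ / 2 := by
    have := (hscont.sub_const q₀).norm
    rw [sub_self, norm_zero] at this
    exact this.eventually (gt_mem_nhds (half_pos hδ))
  have hHρ : ∀ᶠ x in 𝓝 (0 : 𝔼 n), ‖H x‖ < ρ / 2 := by
    have := hH0.norm
    rw [norm_zero] at this
    exact this.eventually (gt_mem_nhds (half_pos hρ))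
  have hall := (hsω.eventually (by simp)).and (hunit.and (hnear.and (hHρ.and
    (hH0.eventually hmχ.eventually_nhds))))
  obtain ⟨r, hr, hrball⟩ := Metric.eventually_nhds_iff_ball.1 hall
  have hmsource : ∀ {x}, ‖H x‖ < ρ / 2 → H x ∈ e.source := fun {x} hx =>
    hρball (by rw [mem_ball_zero_iff]; linarith)
  refine ⟨Metric.ball 0 r, s, Metric.isOpen_ball, Metric.mem_ball_self hr, hs0, ?_, ?_, ?_, ?_, ?_⟩
  · exact fun x hx => ((hrball x hx).1.of_le le_top).contDiffWithinAt
  · intro x hx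
    change m (χ (H x)) = 0
    rw [(hrball x hx).2.2.2.2.self_of_nhds, hDH]
  · intro x hx u T hT hu
    obtain ⟨a, rfl⟩ := exists_coordL_eq 𝔥 hT
    obtain ⟨φ, hφ⟩ := (hrball x hx).2.1
    have h0 : φ.val (-a, u) = 0 := by
      rw [hφ]
      simp [hu]
    have h1 := congrArg φ⁻¹.val h0
    rw [← mul_apply_eq_comp, Units.inv_mul, map_zero] at h1
    exact congrArg Prod.snd h1
  · intro x hx y hy T hT hxy
    obtain ⟨X, hX, hXε, rfl⟩ := hδexp T hT (by
      calc ‖T q₀ - q₀‖ = ‖T (q₀ - s x) + (s y - q₀)‖ := by rw [map_sub, hxy]; congr 1; abel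
        _ ≤ ‖T (q₀ - s x)‖ + ‖s y - q₀‖ := norm_add_le _ _
        _ = ‖s x - q₀‖ + ‖s y - q₀‖ := by rw [hS.isometry T hT, norm_sub_rev]
        _ < δ := by linarith [(hrball x hx).2.2.1, (hrball y hy).2.2.1])
    have hX1 : ‖X q₀‖ < ρ / 2 := by
      calc ‖X q₀‖ ≤ ‖X‖ * ‖q₀‖ := X.le_opNorm _
        _ ≤ ‖X‖ * (‖q₀‖ + 1) := by gcongr; linarith
        _ < ρ / 2 / (‖q₀‖ + 1) * (‖q₀‖ + 1) := by gcongr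
        _ = ρ / 2 := by field_simp
    have hsrc : X q₀ + H x ∈ e.source := hρball (by
      rw [mem_ball_zero_iff]
      linarith [norm_add_le (X q₀) (H x), (hrball x hx).2.2.2.1])
    have heq : e (X q₀ + H x) = e (H y) := by
      rw [he, he, hexp0]
      change NormedSpace.exp (α (X q₀ + H x)) (χ (X q₀ + H x - α (X q₀ + H x) q₀)) = χ (H y)
      rw [hα X hX, add_sub_cancel_left]
      exact hxy
    have := congrArg η (e.injOn hsrc (hmsource (hrball y hy).2.2.2.1) heq)
    rwa [hη X hX, hηH] at this
  · intro x hx N hN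
    have hsrc := hmsource (hrball x hx).2.2.2.1
    have hmap := e.map_nhds_eq hsrc
    rw [he, hexp0] at hmap
    change ∀ᶠ q in 𝓝 (χ (H x)), _
    rw [← hmap, eventually_map]
    have t1 : Tendsto η (𝓝 (H x)) (𝓝 x) := by
      have := η.continuous.tendsto (H x)
      rwa [hηH] at this
    have t2 : Tendsto (fun v => v - κ v) (𝓝 (H x)) (𝓝 (H x)) := by
      have hc : Continuous fun v => v - κ v := by fun_prop
      have := hc.tendsto (H x)
      rwa [hκ, hαH, _root_.zero_apply, sub_zero] at this
    filter_upwards [t1.eventually hN, t2.eventually (hrball x hx).2.2.2.2] with v hvN hvm hv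
    have hinv : m (χ (v - κ v)) = 0 := by
      have := hmS _ (hS.exp_mem (𝔥.neg_mem (hα𝔥 v))) _ hv
      rwa [he, ← mul_apply_eq_comp, exp_neg_mul_exp', one_apply_eq_self] at this
    rw [hvm, map_sub, hκ, hD𝔥 _ (hα𝔥 v), sub_zero] at hinv
    refine ⟨_, hS.exp_mem (hα𝔥 v), η v, hvN, ?_⟩
    have hveq := hker v hinv
    change NormedSpace.exp (α v) (χ (v - α v q₀)) = NormedSpace.exp (α v) (χ (H (η v)))
    congr 2
    rw [sub_eq_iff_eq_add']
    exact hveq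

end SliceExistence

/-! ## Infinitesimal properties of operator groups -/

section Infinitesimal

theorem Submodule.mem_of_hasDerivAt {E : Type*} [NormedAddCommGroup E] [NormedSpace ℝ E]
    {K : Submodule ℝ E} (hK : IsClosed (K : Set E)) {γ : ℝ → E} {v : E} {t : ℝ}
    (hγ : HasDerivAt γ v t) (hmem : ∀ s, γ s ∈ K) : v ∈ K := by
  refine hK.mem_of_tendsto (hasDerivAt_iff_tendsto_slope.1 hγ) (Eventually.of_forall fun s => ?_)
  exact K.smul_mem _ (K.sub_mem (hmem s) (hmem t))

theorem hasDerivAt_exp_smul_zero {𝔸 : Type*} [NormedRing 𝔸] [NormedAlgebra ℝ 𝔸] [CompleteSpace 𝔸]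
    (X : 𝔸) : HasDerivAt (fun t : ℝ => NormedSpace.exp (t • X)) X 0 := by
  have := hasDerivAt_exp_smul_const (𝕂 := ℝ) X (0 : ℝ)
  rwa [zero_smul, NormedSpace.exp_zero, one_mul] at this

variable {V : Type*} [NormedAddCommGroup V] [InnerProductSpace ℝ V] [FiniteDimensional ℝ V]

theorem hasDerivAt_exp_smul_apply (X : V →L[ℝ] V) (v : V) (t : ℝ) :
    HasDerivAt (fun t : ℝ => NormedSpace.exp (t • X) v) (NormedSpace.exp (t • X) (X v)) t := by
  have : CompleteSpace V := FiniteDimensional.complete ℝ V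
  have := (hasDerivAt_exp_smul_const (𝕂 := ℝ) X t).clm_apply (hasDerivAt_const t v)
  simpa using this

theorem exp_smul_apply_eq_self {X : V →L[ℝ] V} {v : V} (h : X v = 0) (t : ℝ) :
    NormedSpace.exp (t • X) v = v := by
  have hd : ∀ t, HasDerivAt (fun t : ℝ => NormedSpace.exp (t • X) v) 0 t := fun t => by
    simpa [h] using hasDerivAt_exp_smul_apply X v t
  have := is_const_of_deriv_eq_zero (fun t => (hd t).differentiableAt) (fun t => (hd t).deriv) t 0
  simpa using this

theorem hasDerivAt_exp_smul_clm (X : V →L[ℝ] V) :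
    HasDerivAt (fun t : ℝ => NormedSpace.exp (t • X)) X 0 :=
  have : CompleteSpace V := FiniteDimensional.complete ℝ V
  hasDerivAt_exp_smul_zero X

theorem continuous_exp_smul_clm (X : V →L[ℝ] V) :
    Continuous fun t : ℝ => NormedSpace.exp (t • X) :=
  have : CompleteSpace V := FiniteDimensional.complete ℝ V
  continuous_iff_continuousAt.2 fun t => (hasDerivAt_exp_smul_const (𝕂 := ℝ) X t).continuousAt

omit [FiniteDimensional ℝ V] in
theorem map_exp_clm {𝔸 : Type*} [NormedRing 𝔸] [NormedAlgebra ℝ 𝔸] [CompleteSpace 𝔸]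
    (f : 𝔸 →ₐ[ℝ] V →L[ℝ] V) (hf : Continuous f) (a : 𝔸) :
    f (NormedSpace.exp a) = NormedSpace.exp (f a) := by
  let _ : NormedAlgebra ℚ 𝔸 := NormedAlgebra.restrictScalars ℚ ℝ 𝔸
  let _ : NormedAlgebra ℚ (V →L[ℝ] V) := NormedAlgebra.restrictScalars ℚ ℝ _
  exact NormedSpace.map_exp f hf a

theorem eq_zero_of_exp_smul_eq_one {X : V →L[ℝ] V} (h : ∀ t : ℝ, NormedSpace.exp (t • X) = 1) :
    X = 0 := by
  have : CompleteSpace V := FiniteDimensional.complete ℝ V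
  have h1 := hasDerivAt_exp_smul_zero X
  simp only [h] at h1
  exact h1.unique (hasDerivAt_const 0 1)

namespace IsOperatorGroup

variable {S : Set (V →L[ℝ] V)} {𝔥 : Submodule ℝ (V →L[ℝ] V)} (hS : IsOperatorGroup S 𝔥)

include hS

theorem skew {T : V →L[ℝ] V} (hT : T ∈ 𝔥) (v w : V) : inner ℝ (T v) w = -inner ℝ v (T w) := by
  have diag : ∀ v, inner ℝ v (T v) = (0 : ℝ) := by
    intro v
    have h1 := (hasDerivAt_exp_smul_apply T v 0).norm_sq
    have h2 : (fun t : ℝ => ‖NormedSpace.exp (t • T) v‖ ^ 2) = fun _ => ‖v‖ ^ 2 := by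
      funext t
      rw [hS.isometry _ ((hS.mem_lie T).1 hT t)]
    rw [h2] at h1
    have := h1.unique (hasDerivAt_const _ _)
    simpa using this
  have h := diag (v + w)
  rw [map_add, inner_add_left, inner_add_right, inner_add_right, diag, diag] at h
  linarith [real_inner_comm w (T v)]

theorem lie {T T' : V →L[ℝ] V} (hT : T ∈ 𝔥) (hT' : T' ∈ 𝔥) : T * T' - T' * T ∈ 𝔥 := by
  have : CompleteSpace V := FiniteDimensional.complete ℝ V
  let _ : NormedAlgebra ℚ (V →L[ℝ] V) := NormedAlgebra.restrictScalars ℚ ℝ _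
  have hmem : ∀ t : ℝ, NormedSpace.exp (t • T) * T' * NormedSpace.exp (t • -T) ∈ 𝔥 := by
    intro t
    rw [hS.mem_lie]
    intro r
    let y : (V →L[ℝ] V)ˣ := ⟨NormedSpace.exp (t • T), NormedSpace.exp (t • -T),
      by rw [smul_neg, exp_mul_exp_neg'], by rw [smul_neg, exp_neg_mul_exp']⟩
    have h1 : r • (NormedSpace.exp (t • T) * T' * NormedSpace.exp (t • -T)) =
        (y : V →L[ℝ] V) * (r • T') * (↑y⁻¹ : V →L[ℝ] V) := by
      rw [mul_smul_comm, smul_mul_assoc]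
      rfl
    rw [h1, NormedSpace.exp_units_conj]
    exact hS.mul_mem _ (hS.mul_mem _ ((hS.mem_lie T).1 hT t) _ ((hS.mem_lie T').1 hT' r)) _
      ((hS.mem_lie _).1 (𝔥.neg_mem hT) t)
  have hd := ((hasDerivAt_exp_smul_zero T).mul_const T').mul (hasDerivAt_exp_smul_zero (-T))
  simp only [zero_smul, NormedSpace.exp_zero, mul_one, one_mul, mul_neg] at hd
  rw [sub_eq_add_neg]
  exact Submodule.mem_of_hasDerivAt (Submodule.closed_of_finiteDimensional 𝔥) hd hmem

end IsOperatorGroup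

theorem coordL_eq_sum (𝔥 : Submodule ℝ (V →L[ℝ] V)) (a : Fin (Module.finrank ℝ 𝔥) → ℝ) :
    coordL 𝔥 a = ∑ i, a i • coordL 𝔥 (Pi.single i 1) := by
  conv_lhs => rw [pi_eq_sum_univ' a]
  simp only [map_sum, map_smul]

/-- The coordinates `⟪T q, J_l q⟫` of the moment map, `l = 1, 2, 3`, with `T` in a basis of `𝔥`. -/
noncomputable def momentCoord (𝔥 : Submodule ℝ (V →L[ℝ] V)) (J : Fin 4 → V →L[ℝ] V) (q : V) :
    Fin 3 → Fin (Module.finrank ℝ 𝔥) → ℝ :=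
  fun l i => inner ℝ (coordL 𝔥 (Pi.single i 1) q) (J l.succ q)

theorem momentCoord_eq_iff {𝔥 : Submodule ℝ (V →L[ℝ] V)} {J : Fin 4 → V →L[ℝ] V} {q q' : V} :
    momentCoord 𝔥 J q = momentCoord 𝔥 J q' ↔
      ∀ l, l ≠ 0 → ∀ T ∈ 𝔥, (inner ℝ (T q) (J l q) : ℝ) = inner ℝ (T q') (J l q') := by
  constructor
  · intro h l hl T hT
    obtain ⟨a, rfl⟩ := exists_coordL_eq 𝔥 hT
    obtain ⟨l, rfl⟩ := Fin.exists_succ_eq.2 hl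
    simp only [coordL_eq_sum 𝔥 a, _root_.sum_apply, _root_.smul_apply, sum_inner, inner_smul_left]
    refine Finset.sum_congr rfl fun i _ => ?_
    congr 1
    exact congrFun (congrFun h l) i
  · intro h
    funext l i
    exact h _ l.succ_ne_zero _ (coordL_mem 𝔥 _)

theorem contDiff_momentCoord (𝔥 : Submodule ℝ (V →L[ℝ] V)) (J : Fin 4 → V →L[ℝ] V) :
    ContDiff ℝ ω (momentCoord 𝔥 J) := by
  rw [contDiff_pi]
  intro l
  rw [contDiff_pi]
  intro i
  exact (ContinuousLinearMap.contDiff _).inner ℝ (ContinuousLinearMap.contDiff _)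

theorem momentCoord_smul (𝔥 : Submodule ℝ (V →L[ℝ] V)) (J : Fin 4 → V →L[ℝ] V) (r : ℝ) (q : V) :
    momentCoord 𝔥 J (r • q) = (r ^ 2) • momentCoord 𝔥 J q := by
  funext l i
  simp [momentCoord, inner_smul_left, inner_smul_right]
  ring

/-- Away from a bounded set, the infinitesimal action on a level set of the moment map grows
linearly if the infinitesimal action on the zero level is free. -/
theorem exists_lower_bound {𝔥 : Submodule ℝ (V →L[ℝ] V)} {J : Fin 4 → V →L[ℝ] V}
    (hfree : ∀ q, q ≠ 0 → momentCoord 𝔥 J q = 0 → ∀ T ∈ 𝔥, T q = 0 → T = 0)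
    (κ : Fin 3 → Fin (Module.finrank ℝ 𝔥) → ℝ) :
    ∃ δ > 0, ∃ R > 0, ∀ q, momentCoord 𝔥 J q = κ → R ≤ ‖q‖ → ∀ T ∈ 𝔥, δ * ‖q‖ * ‖T‖ ≤ ‖T q‖ := by
  have : ProperSpace V := FiniteDimensional.proper ℝ V
  have : ProperSpace (V →L[ℝ] V) := FiniteDimensional.proper ℝ _
  have hP : IsCompact (((𝔥 : Set (V →L[ℝ] V)) ∩ Metric.sphere 0 1) ×ˢ Metric.sphere (0 : V) 1) :=
    ((isCompact_sphere _ _).inter_left (Submodule.closed_of_finiteDimensional 𝔥)).prod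
      (isCompact_sphere _ _)
  have hcont : Continuous fun p : (V →L[ℝ] V) × V => ‖p.1 p.2‖ + ‖momentCoord 𝔥 J p.2‖ :=
    (continuous_fst.clm_apply continuous_snd).norm.add
      ((contDiff_momentCoord 𝔥 J).continuous.comp continuous_snd).norm
  obtain ⟨δ, hδ, hle⟩ := hP.exists_forall_le' hcont.continuousOn (a := 0) (by
    rintro ⟨T, q⟩ ⟨⟨hT, hT1⟩, hq1⟩
    rw [mem_sphere_zero_iff_norm] at hT1 hq1
    refine lt_of_le_of_ne (by positivity) fun h0 => ?_
    have ha : ‖T q‖ = 0 := by linarith [norm_nonneg (T q), norm_nonneg (momentCoord 𝔥 J q)]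
    have hb : ‖momentCoord 𝔥 J q‖ = 0 := by
      linarith [norm_nonneg (T q), norm_nonneg (momentCoord 𝔥 J q)]
    have hq0 : q ≠ 0 := by rintro rfl; simp at hq1
    have := hfree q hq0 (norm_eq_zero.1 hb) T hT (norm_eq_zero.1 ha)
    simp [this] at hT1)
  refine ⟨δ / 2, half_pos hδ, 1 + 2 * ‖κ‖ / δ, by positivity, fun q hq hR T hT => ?_⟩
  have hR1 : 1 ≤ ‖q‖ := le_trans (by simp; positivity) hR
  have hqpos : 0 < ‖q‖ := by linarith
  rcases eq_or_ne T 0 with rfl | hT0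
  · simp
  have hTpos : 0 < ‖T‖ := norm_pos_iff.2 hT0
  have h1 := hle (‖T‖⁻¹ • T, ‖q‖⁻¹ • q) ⟨⟨𝔥.smul_mem _ hT, by simp [norm_smul, hTpos.ne']⟩,
    by simp [norm_smul, hqpos.ne']⟩
  have h2 : ‖(‖T‖⁻¹ • T) (‖q‖⁻¹ • q)‖ = ‖T q‖ / (‖q‖ * ‖T‖) := by
    simp [norm_smul]
    field_simp
  have h3 : ‖momentCoord 𝔥 J (‖q‖⁻¹ • q)‖ = ‖κ‖ / ‖q‖ ^ 2 := by
    rw [momentCoord_smul, hq, norm_smul]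
    simp
    field_simp
  simp only [h2, h3] at h1
  have h4 : ‖κ‖ / ‖q‖ ^ 2 ≤ δ / 2 := by
    rw [div_le_iff₀ (by positivity)]
    have : 2 * ‖κ‖ / δ ≤ ‖q‖ ^ 2 := by nlinarith
    rw [div_le_iff₀ hδ] at this
    linarith
  have h5 : δ / 2 ≤ ‖T q‖ / (‖q‖ * ‖T‖) := by linarith
  rwa [le_div_iff₀ (by positivity), ← mul_assoc] at h5

namespace IsQuaternionic

variable {𝔥 : Submodule ℝ (V →L[ℝ] V)} {J : Fin 4 → V →L[ℝ] V} (hJ : IsQuaternionic 𝔥 J)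

include hJ

omit [FiniteDimensional ℝ V] in
theorem inner_add_eq {T : V →L[ℝ] V} (hT : T ∈ 𝔥) {l : Fin 4} (hl : l ≠ 0) (q v : V) :
    inner ℝ (T q) (J l v) + inner ℝ (T v) (J l q) = -2 * inner ℝ (J l (T q)) v := by
  rw [hJ.skew T hT v, ← hJ.J_comm T hT]
  linarith [hJ.J_skew l hl (T q) v, real_inner_comm v (J l (T q))]

omit [FiniteDimensional ℝ V] in
theorem hasFDerivAt_inner {T : V →L[ℝ] V} (hT : T ∈ 𝔥) {l : Fin 4} (hl : l ≠ 0) {E : Type*}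
    [NormedAddCommGroup E] [NormedSpace ℝ E] {s : E → V} {s' : E →L[ℝ] V} {x : E}
    (hs : HasFDerivAt s s' x) :
    HasFDerivAt (fun y => inner ℝ (T (s y)) (J l (s y)))
      ((-2 : ℝ) • (innerSL ℝ (J l (T (s x)))).comp s') x := by
  refine ((T.hasFDerivAt.comp x hs).inner ℝ ((J l).hasFDerivAt.comp x hs)).congr_fderiv ?_
  ext v
  exact hJ.inner_add_eq hT hl (s x) (s' v)

/-- Points of an invariant level set of the moment map with infinitesimally free action are
regular. -/
theorem isRegularPoint {S : Set (V →L[ℝ] V)} (hS : IsOperatorGroup S 𝔥) {q : V}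
    (hinv : ∀ T ∈ S, momentCoord 𝔥 J (T q) = momentCoord 𝔥 J q)
    (hinj : ∀ T ∈ 𝔥, T q = 0 → T = 0) : IsRegularPoint 𝔥 J q := by
  refine ⟨hinj, fun a b hab T hT T' hT' => ?_⟩
  obtain ⟨l, hl, ε, hε⟩ := hJ.J_mul a b hab
  rw [hε]
  have hd := (hJ.hasFDerivAt_inner hT' hl
    (hasDerivAt_exp_smul_apply T q 0).hasFDerivAt).hasDerivAt
  have hc : (fun t : ℝ => (inner ℝ (T' (NormedSpace.exp (t • T) q))
      (J l (NormedSpace.exp (t • T) q)) : ℝ)) = fun _ => inner ℝ (T' q) (J l q) := by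
    funext t
    exact momentCoord_eq_iff.1 (hinv _ ((hS.mem_lie T).1 hT t)) l hl T' hT'
  rw [hc] at hd
  have := hd.unique (hasDerivAt_const _ _)
  have h0 : inner ℝ (J l (T' q)) (T q) = (0 : ℝ) := by simpa using this
  rw [real_inner_comm, h0, mul_zero]

/-- Slices exist at regular points with trivial stabilizer. -/
theorem exists_slice_of_isRegularPoint {S : Set (V →L[ℝ] V)} (hS : IsOperatorGroup S 𝔥)
    {q₀ : V} (hq₀ : IsRegularPoint 𝔥 J q₀)
    (hinv : ∀ T ∈ S, ∀ q, momentCoord 𝔥 J q = momentCoord 𝔥 J q₀ →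
      momentCoord 𝔥 J (T q) = momentCoord 𝔥 J q₀)
    (hfree : ∀ T ∈ S, T q₀ = q₀ → T = 1) {n : ℕ}
    (hn : n + 4 * Module.finrank ℝ 𝔥 = Module.finrank ℝ V) :
    ∃ (U : Set 𝔼 n) (s : 𝔼 n → V),
      IsOpen U ∧ 0 ∈ U ∧ s 0 = q₀ ∧ ContDiffOn ℝ ∞ s U ∧
      (∀ x ∈ U, momentCoord 𝔥 J (s x) = momentCoord 𝔥 J q₀) ∧
      (∀ x ∈ U, ∀ u, ∀ T ∈ 𝔥, fderiv ℝ s x u = T (s x) → u = 0) ∧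
      (∀ x ∈ U, ∀ y ∈ U, ∀ T ∈ S, T (s x) = s y → x = y) ∧
      (∀ x ∈ U, ∀ N ∈ 𝓝 x, ∀ᶠ q in 𝓝 (s x), momentCoord 𝔥 J q = momentCoord 𝔥 J q₀ →
        ∃ T ∈ S, ∃ y ∈ N, q = T (s y)) := by
  set k := Module.finrank ℝ 𝔥 with hk
  let O : (Fin 4 → 𝔥) →ₗ[ℝ] V := IsRegularPoint.orbitSum 𝔥 J q₀
  let K : Submodule ℝ V := LinearMap.range O
  have hmemK : ∀ l, ∀ T ∈ 𝔥, J l (T q₀) ∈ K := by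
    intro l T hT
    refine ⟨Pi.single l ⟨T, hT⟩, ?_⟩
    change ∑ a, J a (((Pi.single l ⟨T, hT⟩ : Fin 4 → 𝔥) a : V →L[ℝ] V) q₀) = _
    rw [Finset.sum_eq_single l (fun b _ hb => by simp [hb]) (by simp)]
    simp
  have horth : ∀ v, (∀ l : Fin 3, ∀ i, inner ℝ (J l.succ (coordL 𝔥 (Pi.single i 1) q₀)) v = (0 : ℝ)) →
      ∀ l, l ≠ 0 → ∀ T ∈ 𝔥, inner ℝ (J l (T q₀)) v = (0 : ℝ) := by
    intro v hv l hl T hT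
    obtain ⟨a, rfl⟩ := exists_coordL_eq 𝔥 hT
    obtain ⟨l, rfl⟩ := Fin.exists_succ_eq.2 hl
    simp only [coordL_eq_sum 𝔥 a, _root_.sum_apply, _root_.smul_apply, map_sum, map_smul,
      sum_inner, inner_smul_left, hv, mul_zero, Finset.sum_const_zero]
  let D : V →L[ℝ] Fin 3 → Fin k → ℝ := ContinuousLinearMap.pi fun l => ContinuousLinearMap.pi
    fun i => (-2 : ℝ) • innerSL ℝ (J l.succ (coordL 𝔥 (Pi.single i 1) q₀))
  have hDapp : ∀ v l i, D v l i = -2 * inner ℝ (J l.succ (coordL 𝔥 (Pi.single i 1) q₀)) v :=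
    fun v l i => rfl
  have hD0 : ∀ v, D v = 0 ↔ ∀ l, l ≠ 0 → ∀ T ∈ 𝔥, inner ℝ (J l (T q₀)) v = (0 : ℝ) := by
    intro v
    refine ⟨fun h => horth v fun l i => ?_, fun h => ?_⟩
    · have := congrFun (congrFun h l) i
      rw [hDapp] at this
      simpa using this
    · funext l i
      rw [hDapp, h _ l.succ_ne_zero _ (coordL_mem 𝔥 _), mul_zero]
      rfl
  have hD : HasFDerivAt (fun q => momentCoord 𝔥 J q - momentCoord 𝔥 J q₀) D q₀ := by
    have h1 : HasFDerivAt (momentCoord 𝔥 J) D q₀ := hasFDerivAt_pi'.2 fun l =>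
      hasFDerivAt_pi'.2 fun i =>
        hJ.hasFDerivAt_inner (coordL_mem 𝔥 _) l.succ_ne_zero (hasFDerivAt_id q₀)
    exact h1.sub_const _
  have hDsurj : Function.Surjective D := by
    let DT : (Fin 3 → Fin k → ℝ) →ₗ[ℝ] V :=
      { toFun := fun w => ∑ l, J l.succ (coordL 𝔥 (w l) q₀)
        map_add' := fun v w => by simp [Finset.sum_add_distrib]
        map_smul' := fun r w => by simp [Finset.smul_sum] }
    have hinj : Function.Injective ((D : V →ₗ[ℝ] Fin 3 → Fin k → ℝ) ∘ₗ DT) := by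
      refine (injective_iff_map_eq_zero _).2 fun w hw => ?_
      have h1 := (hD0 (DT w)).1 hw
      funext l
      have h2 := h1 _ l.succ_ne_zero _ (coordL_mem 𝔥 (w l))
      change inner ℝ _ (∑ l, J l.succ (coordL 𝔥 (w l) q₀)) = (0 : ℝ) at h2
      rw [inner_sum, Finset.sum_eq_single l (fun b _ hb => hq₀.orth _ _
        (fun h => hb (Fin.succ_injective _ h).symm) _ (coordL_mem 𝔥 _) _ (coordL_mem 𝔥 _)) (by simp),
        real_inner_self_eq_norm_sq, hJ.J_norm, ← real_inner_self_eq_norm_sq,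
        inner_self_eq_zero] at h2
      exact coordL_injective 𝔥 (by
        rw [hq₀.inj _ (coordL_mem 𝔥 _) h2]; exact (map_zero (coordL 𝔥)).symm)
    exact Function.Surjective.of_comp (LinearMap.surjective_of_injective hinj)
  have hKfin : Module.finrank ℝ Kᗮ = n := by
    have h1 := K.finrank_add_finrank_orthogonal
    have h2 : Module.finrank ℝ K = 4 * k := IsRegularPoint.finrank_range_orbitSum hJ hq₀
    omega
  let L : 𝔼 n ≃ₗ[ℝ] Kᗮ := LinearEquiv.ofFinrankEq _ _ (by
    rw [hKfin, finrank_euclideanSpace_fin])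
  let H : 𝔼 n →L[ℝ] V :=
    LinearMap.toContinuousLinearMap (Kᗮ.subtype ∘ₗ L.toLinearMap)
  have hHK : ∀ x, H x ∈ Kᗮ := fun x => (L x).2
  have hHinner : ∀ x l, ∀ T ∈ 𝔥, inner ℝ (J l (T q₀)) (H x) = (0 : ℝ) := fun x l T hT =>
    (Submodule.mem_orthogonal _ _).1 (hHK x) _ (hmemK l T hT)
  have hJ0 : ∀ v, J 0 v = v := fun v => by rw [hJ.J_zero]; rfl
  have hind : ∀ q, momentCoord 𝔥 J q - momentCoord 𝔥 J q₀ = 0 ↔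
      momentCoord 𝔥 J q = momentCoord 𝔥 J q₀ := fun q => sub_eq_zero
  have := exists_slice hS (m := fun q => momentCoord 𝔥 J q - momentCoord 𝔥 J q₀)
    ((contDiff_momentCoord 𝔥 J).sub contDiff_const)
    (fun T hT q hq => (hind _).2 (hinv T hT q ((hind _).1 hq))) (sub_self _) hfree hD hDsurj
    (fun T hT => (hD0 _).2 fun l hl T' hT' => by
      have := hq₀.orth l 0 hl T' hT' T hT
      rwa [hJ0] at this) H
    (fun x => (hD0 _).2 fun l _ T hT => hHinner x l T hT) ?_ ?_
  · simpa only [hind] using this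
  · intro v hv
    obtain ⟨a, ⟨T, rfl⟩, b, hb, rfl⟩ := K.exists_add_mem_mem_orthogonal v
    have hT0 : ∀ l, l ≠ 0 → (T l : V →L[ℝ] V) q₀ = 0 := by
      intro l hl
      have h1 := (hD0 _).1 hv l hl _ (T l).2
      rw [inner_add_right, (Submodule.mem_orthogonal _ _).1 hb _ (hmemK l _ (T l).2),
        add_zero] at h1
      change inner ℝ _ (∑ a, J a ((T a : V →L[ℝ] V) q₀)) = (0 : ℝ) at h1
      rw [inner_sum, Finset.sum_eq_single l (fun b _ hb => hq₀.orth _ _ hb.symm _ (T l).2 _ (T b).2)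
        (by simp), real_inner_self_eq_norm_sq, hJ.J_norm, ← real_inner_self_eq_norm_sq,
        inner_self_eq_zero] at h1
      exact h1
    refine ⟨T 0, (T 0).2, L.symm ⟨b, hb⟩, ?_⟩
    congr 1
    · change ∑ a, J a ((T a : V →L[ℝ] V) q₀) = _
      rw [Finset.sum_eq_single 0 (fun b _ hb => by rw [hT0 b hb, map_zero]) (by simp), hJ0]
    · exact (congrArg Subtype.val (L.apply_symm_apply ⟨b, hb⟩)).symm
  · intro T hT x hx
    have h1 := hHinner x 0 T hT
    rw [hJ0, eq_neg_of_add_eq_zero_right hx, inner_neg_right, neg_eq_zero,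
      inner_self_eq_zero] at h1
    rw [h1, zero_add] at hx
    exact ⟨hq₀.inj T hT h1, L.map_eq_zero_iff.1 (Subtype.ext hx)⟩

end IsQuaternionic

end Infinitesimal

/-! ## Quaternionic matrices as operators -/

theorem isTopologicalRing_clm (V : Type*) [NormedAddCommGroup V] [NormedSpace ℝ V] :
    IsTopologicalRing (V →L[ℝ] V) := inferInstance

instance (d : ℕ) : IsTopologicalRing (HSpace d →L[ℝ] HSpace d) :=
  isTopologicalRing_clm _

section Operators

variable {d : ℕ}

theorem mulVec_apply (A : HMat d) (q : HSpace d) (a : Fin d) :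
    mulVec A q a = ∑ b, A a b * q b := rfl

/-- Left multiplication by quaternionic matrices, as a homomorphism to the real operators. -/
noncomputable def opL (d : ℕ) : HMat d →ₐ[ℝ] (HSpace d →L[ℝ] HSpace d) where
  toFun A := LinearMap.toContinuousLinearMap
    { toFun := mulVec A
      map_add' := fun v w => by simp [mulVec, Matrix.mulVec_add]
      map_smul' := fun r v => by simp [mulVec, Matrix.mulVec_smul] }
  map_one' := by ext1 q; change mulVec 1 q = q; simp [mulVec]
  map_mul' A B := by
    ext1 q
    change mulVec (A * B) q = mulVec A (mulVec B q)
    simp [mulVec]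
  map_zero' := by ext1 q; change mulVec 0 q = 0; simp [mulVec]
  map_add' A B := by
    ext1 q
    change mulVec (A + B) q = mulVec A q + mulVec B q
    simp [mulVec, Matrix.add_mulVec]
  commutes' r := by
    ext1 q
    change mulVec (algebraMap ℝ (HMat d) r) q = r • q
    rw [Algebra.algebraMap_eq_smul_one]
    simp [mulVec, Matrix.smul_mulVec]

@[simp] theorem opL_apply (A : HMat d) (q : HSpace d) : opL d A q = mulVec A q := rfl

theorem opL_injective : Function.Injective (opL d) := by
  refine (injective_iff_map_eq_zero _).2 fun A hA => ?_
  ext1 a b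
  have h := congrArg (fun v : HSpace d => v a)
    (DFunLike.congr_fun hA (WithLp.toLp 2 (Pi.single b 1)))
  simpa [mulVec] using h

theorem continuous_opL : Continuous (opL d) :=
  (opL d).toLinearMap.continuous_of_finiteDimensional

theorem isClosedEmbedding_opL : Topology.IsClosedEmbedding (opL d) :=
  LinearMap.isClosedEmbedding_of_injective (f := (opL d).toLinearMap)
    (LinearMap.ker_eq_bot.2 opL_injective)

section

attribute [local instance] Matrix.linftyOpNormedRing Matrix.linftyOpNormedAlgebra

theorem opL_exp (A : HMat d) : opL d (NormedSpace.exp A) = NormedSpace.exp (opL d A) :=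
  map_exp_clm (opL d) continuous_opL A

end

theorem Quaternion.re_mul_comm (a b : ℍ[ℝ]) : (a * b).re = (b * a).re := by
  simp only [Quaternion.re_mul]
  ring

theorem Quaternion.re_sum {ι : Type*} (s : Finset ι) (f : ι → ℍ[ℝ]) :
    (∑ i ∈ s, f i).re = ∑ i ∈ s, (f i).re :=
  map_sum (⟨⟨fun q : ℍ[ℝ] => q.re, rfl⟩, fun _ _ => rfl⟩ : ℍ[ℝ] →+ ℝ) f s

theorem inner_mulVec (A : HMat d) (v w : HSpace d) :
    inner ℝ (mulVec A v) w = inner ℝ v (mulVec (star A) w) := by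
  simp only [PiLp.inner_apply, Quaternion.inner_def, mulVec_apply, Finset.sum_mul, star_sum,
    Finset.mul_sum, Quaternion.re_sum, star_mul, Matrix.star_apply, star_star]
  rw [Finset.sum_comm]
  refine Finset.sum_congr rfl fun b _ => Finset.sum_congr rfl fun a _ => ?_
  rw [mul_assoc, Quaternion.re_mul_comm, mul_assoc]

theorem norm_mulVec (g : Sp d) (v : HSpace d) : ‖mulVec (g : HMat d) v‖ = ‖v‖ := by
  refine (sq_eq_sq₀ (norm_nonneg _) (norm_nonneg _)).1 ?_
  rw [← real_inner_self_eq_norm_sq, ← real_inner_self_eq_norm_sq, inner_mulVec]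
  congr 1
  change (opL d (star (g : HMat d)) * opL d g) v = v
  rw [← map_mul, (Unitary.mem_iff.1 g.2).1, map_one]
  rfl

/-- Right multiplication by a quaternion. -/
noncomputable def rmul (d : ℕ) (u : ℍ[ℝ]) : HSpace d →L[ℝ] HSpace d :=
  LinearMap.toContinuousLinearMap
    { toFun := fun v => WithLp.toLp 2 fun a => v a * u
      map_add' := fun v w => by ext1 a; exact add_mul _ _ _
      map_smul' := fun r v => by ext1 a; exact smul_mul_assoc r (v a) u }

theorem rmul_apply (u : ℍ[ℝ]) (v : HSpace d) (a : Fin d) : rmul d u v a = v a * u := rfl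

theorem inner_rmul_rmul (u w : ℍ[ℝ]) (x y : HSpace d) :
    inner ℝ (rmul d u x) (rmul d w y) = inner ℝ x (rmul d (w * star u) y) := by
  simp only [PiLp.inner_apply, Quaternion.inner_def, rmul_apply, star_mul, star_star, mul_assoc]

theorem rmul_mulVec (u : ℍ[ℝ]) (A : HMat d) (v : HSpace d) :
    rmul d u (mulVec A v) = mulVec A (rmul d u v) := by
  ext1 a
  simp only [rmul_apply, mulVec_apply, Finset.sum_mul, mul_assoc]

theorem rmul_one : rmul d 1 = 1 := by
  ext1 v
  ext1 a
  exact mul_one _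

theorem rmul_smul (r : ℝ) (u : ℍ[ℝ]) (v : HSpace d) : rmul d (r • u) v = r • rmul d u v := by
  ext1 a
  exact mul_smul_comm r (v a) u

/-- The units `1, i, j, k`. -/
def quatUnit : Fin 4 → ℍ[ℝ] := ![1, ⟨0, 1, 0, 0⟩, ⟨0, 0, 1, 0⟩, ⟨0, 0, 0, 1⟩]

theorem quatUnit_comp (l : Fin 4) : (quatUnit l).re = (![1, 0, 0, 0] : Fin 4 → ℝ) l ∧
    (quatUnit l).imI = (![0, 1, 0, 0] : Fin 4 → ℝ) l ∧
    (quatUnit l).imJ = (![0, 0, 1, 0] : Fin 4 → ℝ) l ∧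
    (quatUnit l).imK = (![0, 0, 0, 1] : Fin 4 → ℝ) l := by
  fin_cases l <;> exact ⟨rfl, rfl, rfl, rfl⟩

theorem quatUnit_succ (l : Fin 3) : quatUnit l.succ = imUnit l := by fin_cases l <;> rfl

/-- Right multiplication by `1, i, j, k`. -/
noncomputable def Junit (d : ℕ) (l : Fin 4) : HSpace d →L[ℝ] HSpace d := rmul d (quatUnit l)

theorem quatUnit_mul_star_self (l : Fin 4) : quatUnit l * star (quatUnit l) = 1 := by
  fin_cases l <;> ext <;> simp [quatUnit_comp]

theorem star_quatUnit {l : Fin 4} (hl : l ≠ 0) : star (quatUnit l) = -quatUnit l := by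
  fin_cases l <;> first | exact absurd rfl hl | skip
  all_goals ext <;> simp [quatUnit_comp]

theorem exists_quatUnit_mul_star {a b : Fin 4} (hab : a ≠ b) :
    ∃ c, c ≠ 0 ∧ ∃ ε : ℝ, quatUnit b * star (quatUnit a) = ε • quatUnit c := by
  fin_cases a <;> fin_cases b <;> first
    | exact absurd rfl hab
    | (refine ⟨1, by decide, 1, ?_⟩; ext <;> simp [quatUnit_comp]; done)
    | (refine ⟨1, by decide, -1, ?_⟩; ext <;> simp [quatUnit_comp]; done)
    | (refine ⟨2, by decide, 1, ?_⟩; ext <;> simp [quatUnit_comp]; done)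
    | (refine ⟨2, by decide, -1, ?_⟩; ext <;> simp [quatUnit_comp]; done)
    | (refine ⟨3, by decide, 1, ?_⟩; ext <;> simp [quatUnit_comp]; done)
    | (refine ⟨3, by decide, -1, ?_⟩; ext <;> simp [quatUnit_comp])

end Operators

section Group

variable {d : ℕ} (G : Subgroup (Sp d)) (hG : IsClosed (G : Set (Sp d)))

/-- The group `G` as a set of operators. -/
def opGroup : Set (HSpace d →L[ℝ] HSpace d) := {T | ∃ g ∈ G, opL d (g : HMat d) = T}

/-- The Lie algebra of `G` as a space of operators. -/
noncomputable def opLie : Submodule ℝ (HSpace d →L[ℝ] HSpace d) :=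
  (lieAlg G hG).map (opL d).toLinearMap

variable {G hG}

theorem opL_mem_opLie {A : HMat d} (hA : A ∈ lieAlg G hG) : opL d A ∈ opLie G hG := ⟨A, hA, rfl⟩

theorem finrank_opLie : Module.finrank ℝ (opLie G hG) = Module.finrank ℝ (lieAlg G hG) :=
  (Submodule.equivMapOfInjective _ opL_injective _).finrank_eq.symm

theorem mem_orbitTangent {q v : HSpace d} :
    v ∈ orbitTangent G hG q ↔ ∃ T ∈ opLie G hG, T q = v := by
  constructor
  · rintro ⟨A, hA, rfl⟩
    exact ⟨_, opL_mem_opLie hA, rfl⟩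
  · rintro ⟨_, ⟨A, hA, rfl⟩, rfl⟩
    exact ⟨A, hA, rfl⟩

theorem isOperatorGroup : IsOperatorGroup (opGroup G) (opLie G hG) where
  isClosed := by
    have := isClosedEmbedding_opL.isClosedMap _ (isClosed_coe_image G hG)
    convert this using 1
    ext T
    simp [opGroup]
  one_mem := ⟨1, G.one_mem, map_one _⟩
  mul_mem := by
    rintro _ ⟨g, hg, rfl⟩ _ ⟨h, hh, rfl⟩
    exact ⟨g * h, G.mul_mem hg hh, map_mul _ _ _⟩
  inv_mem := by
    rintro _ ⟨g, hg, rfl⟩ T hT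
    refine ⟨g⁻¹, G.inv_mem hg, ?_⟩
    have h1 : opL d ((g⁻¹ : Sp d) : HMat d) * opL d (g : HMat d) = 1 := by
      rw [← map_mul, ← map_one (opL d)]
      exact congrArg _ (congrArg Subtype.val (inv_mul_cancel g))
    exact left_inv_eq_right_inv h1 hT
  isometry := by
    rintro _ ⟨g, -, rfl⟩ v
    exact norm_mulVec g v
  mem_lie X := by
    constructor
    · rintro ⟨A, hA, rfl⟩ t
      obtain ⟨g, hg, hg'⟩ := hA t
      refine ⟨g, hg, ?_⟩
      rw [hg', opL_exp, map_smul]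
      rfl
    · intro h
      have hX : X ∈ LinearMap.range (opL d).toLinearMap :=
        Submodule.mem_of_hasDerivAt (Submodule.closed_of_finiteDimensional _)
          (hasDerivAt_exp_smul_clm X) fun t => by
            obtain ⟨g, -, hg⟩ := h t
            exact ⟨g, hg⟩
      obtain ⟨A, rfl⟩ := hX
      refine ⟨A, fun t => ?_, rfl⟩
      obtain ⟨g, hg, hg'⟩ := h t
      refine ⟨g, hg, opL_injective ?_⟩
      rw [hg', opL_exp, map_smul]
      rfl

theorem isQuaternionic : IsQuaternionic (opLie G hG) (Junit d) where
  skew T hT := isOperatorGroup.skew hT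
  lie T hT T' hT' := isOperatorGroup.lie hT hT'
  J_zero := rmul_one
  J_comm := by
    rintro _ ⟨A, -, rfl⟩ l v
    exact rmul_mulVec _ A v
  J_norm l v := by
    refine (sq_eq_sq₀ (norm_nonneg _) (norm_nonneg _)).1 ?_
    rw [← real_inner_self_eq_norm_sq, ← real_inner_self_eq_norm_sq, Junit, inner_rmul_rmul,
      quatUnit_mul_star_self, rmul_one]
    rfl
  J_skew l hl v w := by
    have h := inner_rmul_rmul (quatUnit l) 1 v w
    rw [rmul_one, one_mul, star_quatUnit hl, ← neg_one_smul ℝ (quatUnit l), rmul_smul,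
      inner_smul_right, neg_one_mul] at h
    exact h
  J_mul a b hab := by
    obtain ⟨c, hc, ε, h⟩ := exists_quatUnit_mul_star hab
    refine ⟨c, hc, ε, fun v w => ?_⟩
    rw [Junit, Junit, inner_rmul_rmul, h, rmul_smul, inner_smul_right]
    rfl

/-! ## The level sets of the moment map -/

theorem matEuclid_apply (A : HMat d) (p : Fin d × Fin d) : matEuclid d A p = A p.1 p.2 := rfl

theorem inner_matEuclid_spMoment (l : Fin 3) (q : HSpace d) (A : HMat d) :
    inner ℝ (matEuclid d (spMoment l q)) (matEuclid d A) =
      inner ℝ (opL d A q) (Junit d l.succ q) := by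
  simp only [PiLp.inner_apply, Quaternion.inner_def, opL_apply, mulVec_apply, Junit, rmul_apply,
    quatUnit_succ, matEuclid_apply, spMoment, Matrix.of_apply, Finset.sum_mul, Quaternion.re_sum,
    Fintype.sum_prod_type]
  refine Finset.sum_congr rfl fun a _ => Finset.sum_congr rfl fun b _ => ?_
  rw [← Quaternion.re_star]
  simp only [star_mul, star_star, mul_assoc]

theorem momentMap_eq_iff (q q' : HSpace d) :
    (∀ l, momentMap G hG l q = momentMap G hG l q') ↔
      momentCoord (opLie G hG) (Junit d) q = momentCoord (opLie G hG) (Junit d) q' := by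
  rw [momentCoord_eq_iff]
  have key : ∀ l : Fin 3, momentMap G hG l q = momentMap G hG l q' ↔ ∀ A ∈ lieAlg G hG,
      (inner ℝ (matEuclid d (spMoment l q)) (matEuclid d A) : ℝ) =
        inner ℝ (matEuclid d (spMoment l q')) (matEuclid d A) := by
    intro l
    rw [momentMap, momentMap, (matEuclid d).symm.injective.eq_iff, ← sub_eq_zero, ← map_sub,
      Submodule.starProjection_apply_eq_zero_iff, Submodule.mem_orthogonal']
    constructor
    · intro h A hA
      have := h _ (Submodule.mem_map_of_mem hA)
      rwa [inner_sub_left, sub_eq_zero] at this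
    · rintro h _ ⟨A, hA, rfl⟩
      rw [inner_sub_left, sub_eq_zero]
      exact h A hA
  simp only [key, inner_matEuclid_spMoment]
  constructor
  · rintro h l hl _ ⟨A, hA, rfl⟩
    obtain ⟨l, rfl⟩ := Fin.exists_succ_eq.2 hl
    exact h l A hA
  · exact fun h l A hA => h _ l.succ_ne_zero _ (opL_mem_opLie hA)

theorem mem_levelSet_iff {c : Fin 3 → HMat d} {q₀ : HSpace d} (hq₀ : q₀ ∈ levelSet G hG c)
    (q : HSpace d) : q ∈ levelSet G hG c ↔
      momentCoord (opLie G hG) (Junit d) q = momentCoord (opLie G hG) (Junit d) q₀ := by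
  rw [← momentMap_eq_iff]
  exact forall_congr' fun l => by rw [hq₀ l]

theorem momentCoord_zero {V : Type*} [NormedAddCommGroup V] [InnerProductSpace ℝ V]
    [FiniteDimensional ℝ V] (𝔥 : Submodule ℝ (V →L[ℝ] V)) (J : Fin 4 → V →L[ℝ] V) :
    momentCoord 𝔥 J 0 = 0 := by
  funext l i
  simp [momentCoord]

theorem zero_mem_levelSet : (0 : HSpace d) ∈ levelSet G hG 0 := by
  intro l
  have : spMoment l (0 : HSpace d) = 0 := by
    ext1 a b
    simp [spMoment]
  simp [momentMap, this]

theorem isClosed_levelSet (c : Fin 3 → HMat d) : IsClosed (levelSet G hG c) := by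
  rcases (levelSet G hG c).eq_empty_or_nonempty with h | ⟨q₀, hq₀⟩
  · rw [h]; exact isClosed_empty
  · have : levelSet G hG c = {q | momentCoord (opLie G hG) (Junit d) q =
        momentCoord (opLie G hG) (Junit d) q₀} := Set.ext fun q => mem_levelSet_iff hq₀ q
    rw [this]
    exact isClosed_eq (contDiff_momentCoord _ _).continuous continuous_const

/-- Local freeness implies that the infinitesimal action is free. -/
theorem eq_zero_of_discrete_stabilizer {q : HSpace d}
    (hq : DiscreteTopology (MulAction.stabilizer G q)) {T : HSpace d →L[ℝ] HSpace d}
    (hT : T ∈ opLie G hG) (hTq : T q = 0) : T = 0 := by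
  obtain ⟨A, hA, rfl⟩ := hT
  refine eq_zero_of_exp_smul_eq_one fun t => ?_
  choose g hg hg' using hA
  have hgA : ∀ t, opL d (g t : HMat d) = NormedSpace.exp (t • opL d A) := fun t => by
    rw [hg', opL_exp, map_smul]
  have hfix : ∀ t, (⟨g t, hg t⟩ : G) ∈ MulAction.stabilizer G q := by
    intro t
    rw [MulAction.mem_stabilizer_iff]
    change opL d (g t : HMat d) q = q
    rw [hgA]
    exact exp_smul_apply_eq_self hTq t
  have hcont : Continuous fun t => (⟨⟨g t, hg t⟩, hfix t⟩ : MulAction.stabilizer G q) := by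
    refine Continuous.subtype_mk (Continuous.subtype_mk (continuous_induced_rng.2 ?_) _) _
    have hc : Continuous fun t => opL d (g t : HMat d) := by
      simp only [hgA]
      exact continuous_exp_smul_clm _
    exact isClosedEmbedding_opL.isInducing.continuous_iff.2 hc
  have hconst := PreconnectedSpace.constant (inferInstance : PreconnectedSpace ℝ) hcont
    (x := t) (y := 0)
  have h2 : g t = g 0 := congrArg (fun z : MulAction.stabilizer G q => ((z : G) : Sp d)) hconst
  change NormedSpace.exp (t • opL d A) = 1
  rw [← hgA, h2, hg', zero_smul, NormedSpace.exp_zero, map_one]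

end Group

section Quotient

variable {d : ℕ} {G : Subgroup (Sp d)} {hG : IsClosed (G : Set (Sp d))} {c : Fin 3 → HMat d}

theorem finrank_HSpace (d : ℕ) : Module.finrank ℝ (HSpace d) = 4 * d := by
  rw [(WithLp.linearEquiv 2 ℝ (Fin d → ℍ[ℝ])).finrank_eq, Module.finrank_pi_fintype]
  simp [Quaternion.finrank_eq_four, mul_comm]

theorem mem_levelSet_iff_of_mem (hfree : ActsFreelyOn G (levelSet G hG c)) {q : HSpace d}
    (hq : q ∈ levelSet G hG c) {T : HSpace d →L[ℝ] HSpace d} (hT : T ∈ opGroup G) :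
    momentCoord (opLie G hG) (Junit d) (T q) = momentCoord (opLie G hG) (Junit d) q := by
  obtain ⟨g, hg, rfl⟩ := hT
  exact (mem_levelSet_iff hq _).1 (hfree.1 g hg q hq)

theorem eq_one_of_apply_eq_self (hfree : ActsFreelyOn G (levelSet G hG c)) {q : HSpace d}
    (hq : q ∈ levelSet G hG c) {T : HSpace d →L[ℝ] HSpace d} (hT : T ∈ opGroup G)
    (hTq : T q = q) : T = 1 := by
  obtain ⟨g, hg, rfl⟩ := hT
  have h1 : (⟨g, hg⟩ : G) ∈ MulAction.stabilizer G q := MulAction.mem_stabilizer_iff.2 hTq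
  rw [hfree.2 q hq, Subgroup.mem_bot] at h1
  have h2 : g = 1 := congrArg Subtype.val h1
  rw [h2]
  exact map_one (opL d)

theorem isRegularPoint_of_mem_levelSet (hfree : ActsFreelyOn G (levelSet G hG c)) {q : HSpace d}
    (hq : q ∈ levelSet G hG c) : IsRegularPoint (opLie G hG) (Junit d) q := by
  refine isQuaternionic.isRegularPoint isOperatorGroup
    (fun T hT => mem_levelSet_iff_of_mem hfree hq hT) fun T hT hTq => ?_
  refine eq_zero_of_exp_smul_eq_one fun t => ?_
  exact eq_one_of_apply_eq_self hfree hq ((isOperatorGroup.mem_lie T).1 hT t)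
    (exp_smul_apply_eq_self hTq t)

theorem quotDim_add (hfree : ActsFreelyOn G (levelSet G hG c)) {q : HSpace d}
    (hq : q ∈ levelSet G hG c) :
    quotDim G hG + 4 * Module.finrank ℝ (opLie G hG) = Module.finrank ℝ (HSpace d) := by
  have h1 := IsRegularPoint.finrank_range_orbitSum isQuaternionic
    (isRegularPoint_of_mem_levelSet hfree hq)
  have h2 := Submodule.finrank_le
    (LinearMap.range (IsRegularPoint.orbitSum (opLie G hG) (Junit d) q))
  rw [h1, finrank_HSpace, finrank_opLie] at h2
  rw [finrank_HSpace, finrank_opLie, quotDim]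
  omega

theorem proj_eq_proj_iff {q q' : levelSet G hG c} :
    proj G hG c q = proj G hG c q' ↔ ∃ T ∈ opGroup G, T (q' : HSpace d) = q := by
  have h1 : proj G hG c q = proj G hG c q' ↔ ∃ g : G, g • (q' : HSpace d) = q :=
    Quotient.eq (r := orbitSetoid G hG c)
  rw [h1]
  constructor
  · rintro ⟨g, hg⟩
    exact ⟨_, ⟨g, g.2, rfl⟩, hg⟩
  · rintro ⟨_, ⟨g, hg, rfl⟩, h⟩
    exact ⟨⟨g, hg⟩, h⟩

theorem continuous_proj : Continuous (proj G hG c) := continuous_quotient_mk'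

theorem surjective_proj : Function.Surjective (proj G hG c) := Quotient.mk_surjective

theorem isOpen_iff_preimage_proj {s : Set (QuotSpace G hG c)} :
    IsOpen s ↔ IsOpen (proj G hG c ⁻¹' s) := Iff.rfl

/-! ## Charts of the quotient -/

theorem isOpenEmbedding_proj_comp (hfree : ActsFreelyOn G (levelSet G hG c)) {q₀ : HSpace d}
    (hq₀ : q₀ ∈ levelSet G hG c) {n : ℕ} {U : Set 𝔼 n} (hU : IsOpen U)
    {s : 𝔼 n → HSpace d} (hs : ContinuousOn s U)
    (hmem : ∀ x ∈ U, s x ∈ levelSet G hG c)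
    (hinj : ∀ x ∈ U, ∀ y ∈ U, ∀ T ∈ opGroup G, T (s x) = s y → x = y)
    (hopen : ∀ x ∈ U, ∀ N ∈ 𝓝 x, ∀ᶠ q in 𝓝 (s x),
      momentCoord (opLie G hG) (Junit d) q = momentCoord (opLie G hG) (Junit d) q₀ →
        ∃ T ∈ opGroup G, ∃ y ∈ N, q = T (s y)) :
    Topology.IsOpenEmbedding fun x : U => proj G hG c ⟨s x, hmem x x.2⟩ := by
  refine .of_continuous_injective_isOpenMap ?_ ?_ ?_
  · exact continuous_proj.comp (hs.domRestrict.subtype_mk _)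
  · intro x y hxy
    obtain ⟨T, hT, h⟩ := proj_eq_proj_iff.1 hxy
    exact Subtype.ext (hinj y y.2 x x.2 T hT h).symm
  · intro W hW
    rw [isOpen_iff_preimage_proj, isOpen_iff_mem_nhds]
    rintro ⟨q, hq⟩ ⟨x, hxW, hx⟩
    obtain ⟨T, hT, h⟩ := proj_eq_proj_iff.1 hx
    have hN : (Subtype.val '' W : Set 𝔼 n) ∈ 𝓝 x.1 :=
      (hU.isOpenMap_subtype_val _ hW).mem_nhds ⟨x, hxW, rfl⟩
    have hev := hopen x x.2 _ hN
    have hT' : T q = s x := h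
    rw [← hT'] at hev
    have hc : Tendsto (fun z : levelSet G hG c => T z) (𝓝 ⟨q, hq⟩) (𝓝 (T q)) :=
      (T.continuous.comp continuous_subtype_val).tendsto _
    filter_upwards [hc.eventually hev] with z hz
    obtain ⟨T', hT2, _, ⟨y, hyW, rfl⟩, hy⟩ := hz (by
      rw [mem_levelSet_iff_of_mem hfree z.2 hT]
      exact (mem_levelSet_iff hq₀ _).1 z.2)
    refine ⟨y, hyW, ?_⟩
    have h1 : proj G hG c ⟨T z, by
        rw [mem_levelSet_iff hq₀, mem_levelSet_iff_of_mem hfree z.2 hT]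
        exact (mem_levelSet_iff hq₀ _).1 z.2⟩ = proj G hG c z := proj_eq_proj_iff.2 ⟨T, hT, rfl⟩
    rw [← h1]
    exact (proj_eq_proj_iff.2 ⟨T', hT2, hy.symm⟩).symm

theorem exists_chart (hfree : ActsFreelyOn G (levelSet G hG c)) (p : QuotSpace G hG c) :
    ∃ φ : Chart G hG c, ∃ x : φ.source, φ.point x = p := by
  obtain ⟨⟨q₀, hq₀⟩, rfl⟩ := surjective_proj p
  obtain ⟨U, s, hU, h0, hs0, hs, hmom, htr, hinj, hopen⟩ :=
    isQuaternionic.exists_slice_of_isRegularPoint isOperatorGroup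
      (isRegularPoint_of_mem_levelSet hfree hq₀)
      (fun T hT q hq => by
        rw [← hq]
        exact mem_levelSet_iff_of_mem hfree ((mem_levelSet_iff hq₀ q).2 hq) hT)
      (fun T hT h => eq_one_of_apply_eq_self hfree hq₀ hT h) (quotDim_add hfree hq₀)
  have hmem : ∀ x ∈ U, s x ∈ levelSet G hG c := fun x hx =>
    (mem_levelSet_iff hq₀ _).2 (hmom x hx)
  refine ⟨{ source := U
            isOpen_source := hU
            slice := s
            contDiffOn_slice := hs
            slice_mem := hmem
            transverse := fun x hx u hu => ?_
            isOpenEmbedding := isOpenEmbedding_proj_comp hfree hq₀ hU hs.continuousOn hmem hinj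
              hopen }, ⟨0, h0⟩, ?_⟩
  · obtain ⟨T, hT, h⟩ := mem_orbitTangent.1 hu
    exact htr x hx u T hT h.symm
  · exact congrArg (proj G hG c) (Subtype.ext hs0)

theorem Chart.isSlice (φ : Chart G hG c) (hfree : ActsFreelyOn G (levelSet G hG c))
    (hne : φ.source.Nonempty) : IsSlice (opLie G hG) (Junit d) φ.source φ.slice where
  isOpen := φ.isOpen_source
  smooth := φ.contDiffOn_slice
  regular x hx := isRegularPoint_of_mem_levelSet hfree (φ.slice_mem x hx)
  tangent x hx u l hl T hT := by
    have hs : HasFDerivAt φ.slice (fderiv ℝ φ.slice x) x :=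
      ((φ.contDiffOn_slice.contDiffAt (φ.isOpen_source.mem_nhds hx)).differentiableAt
        (by simp)).hasFDerivAt
    have h1 := isQuaternionic.hasFDerivAt_inner hT hl hs
    have h2 : (fun y => (inner ℝ (T (φ.slice y)) (Junit d l (φ.slice y)) : ℝ)) =ᶠ[𝓝 x]
        fun _ => inner ℝ (T (φ.slice x)) (Junit d l (φ.slice x)) := by
      filter_upwards [φ.isOpen_source.mem_nhds hx] with y hy
      exact momentCoord_eq_iff.1
        ((mem_levelSet_iff (φ.slice_mem x hx) _).1 (φ.slice_mem y hy)) l hl T hT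
    have h3 := h1.unique ((hasFDerivAt_const _ x).congr_of_eventuallyEq h2)
    have h4 := DFunLike.congr_fun h3 u
    rw [real_inner_comm]
    simpa using h4
  transverse x hx u T hT h := φ.transverse x hx u (mem_orbitTangent.2 ⟨T, hT, h.symm⟩)
  finrank_eq := hne.elim fun x hx => quotDim_add hfree (φ.slice_mem x hx)

theorem Chart.metric_eq (φ : Chart G hG c) (hfree : ActsFreelyOn G (levelSet G hG c))
    {x : EuclideanSpace ℝ (Fin (quotDim G hG))} (hx : x ∈ φ.source)
    (i j : Fin (quotDim G hG)) :
    φ.metric x i j =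
      inner ℝ (hframe (opLie G hG) φ.slice i x) (hframe (opLie G hG) φ.slice j x) := by
  have key : ∀ i, (orbitTangent G hG (φ.slice x))ᗮ.starProjection
      (fderiv ℝ φ.slice x (EuclideanSpace.single i 1)) = hframe (opLie G hG) φ.slice i x := by
    intro i
    have hsl := φ.isSlice hfree ⟨x, hx⟩
    refine (Submodule.eq_starProjection_of_mem_orthogonal ?_ ?_)
    · rw [Submodule.mem_orthogonal']
      intro v hv
      obtain ⟨T, hT, rfl⟩ := mem_orbitTangent.1 hv
      exact hsl.inner_covD_orbit hx _ hT
    · refine Submodule.le_orthogonal_orthogonal _ (mem_orbitTangent.2 ⟨_,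
        conn_mem (opLie G hG) φ.slice (EuclideanSpace.single i 1) x, ?_⟩)
      rw [hframe, covD]
      abel
  rw [Chart.metric, Matrix.of_apply, key, key]

/-! ## Asymptotic behaviour of the curvature -/

theorem Chart.abs_sectionalCurvature_le (φ : Chart G hG c)
    (hfree : ActsFreelyOn G (levelSet G hG c)) {x u v : EuclideanSpace ℝ (Fin (quotDim G hG))}
    (hx : x ∈ φ.source) {δ : ℝ} (hδ : 0 < δ)
    (hb : ∀ T ∈ opLie G hG, δ * ‖T‖ ≤ ‖T (φ.slice x)‖) (huv : LinearIndependent ℝ ![u, v]) :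
    |sectionalCurvature φ.metric x u v| ≤ 40 / δ ^ 2 := by
  have hsl := φ.isSlice hfree ⟨x, hx⟩
  have hg : ∀ y ∈ φ.source, ∀ i j, φ.metric y i j =
      inner ℝ (hframe (opLie G hG) φ.slice i y) (hframe (opLie G hG) φ.slice j y) :=
    fun y hy i j => φ.metric_eq hfree hy i j
  exact hsl.abs_sectionalCurvature_le isQuaternionic hx hg hδ hb huv

theorem isCompact_levelSet_norm_le (c : Fin 3 → HMat d) (R : ℝ) :
    IsCompact {q : levelSet G hG c | ‖(q : HSpace d)‖ ≤ R} := by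
  have : ProperSpace (HSpace d) := FiniteDimensional.proper ℝ _
  refine (isClosed_levelSet c).isClosedEmbedding_subtypeVal.isCompact_preimage
    (K := {q : HSpace d | ‖q‖ ≤ R}) ?_
  simpa [Metric.closedBall, dist_zero_right] using isCompact_closedBall (0 : HSpace d) R

theorem asymptoticallyNullCurvature (hlf : ActsLocallyFreelyOn G (levelSet G hG 0 \ {0}))
    (hfree : ActsFreelyOn G (levelSet G hG c)) : AsymptoticallyNullCurvature G hG c := by
  intro ε hε
  rcases isEmpty_or_nonempty (levelSet G hG c) with hemp | ⟨⟨q₀, hq₀⟩⟩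
  · refine ⟨∅, isCompact_empty, fun p => ?_⟩
    obtain ⟨q, -⟩ := surjective_proj p
    exact hemp.elim q
  obtain ⟨δ, hδ, R, hR, hbound⟩ := exists_lower_bound (𝔥 := opLie G hG) (J := Junit d)
    (fun q hq0 hq T hT hTq => by
      refine eq_zero_of_discrete_stabilizer (hlf q ⟨?_, hq0⟩) hT hTq
      rw [mem_levelSet_iff zero_mem_levelSet, hq, momentCoord_zero])
    (momentCoord (opLie G hG) (Junit d) q₀)
  set R' := max R (41 / (δ ^ 2 * ε) + 1)
  have hcpt := isCompact_levelSet_norm_le (G := G) (hG := hG) c R'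
  refine ⟨_, hcpt.image continuous_proj, ?_⟩
  rintro p hp K ⟨φ, x, u, v, rfl, huv, rfl⟩
  have hmem := φ.slice_mem x x.2
  have hq : R' < ‖φ.slice x‖ := by
    by_contra h
    exact hp (Set.mem_image_of_mem (proj G hG c) (x := ⟨φ.slice x, hmem⟩) (not_lt.1 h))
  have hnorm : 0 < ‖φ.slice x‖ := hR.trans ((le_max_left _ _).trans_lt hq)
  have hle := φ.abs_sectionalCurvature_le hfree x.2 (mul_pos hδ hnorm)
    (hbound _ ((mem_levelSet_iff hq₀ _).1 hmem) ((le_max_left _ _).trans hq.le)) huv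
  refine hle.trans_lt ?_
  have h1 : 41 / (δ ^ 2 * ε) + 1 < ‖φ.slice x‖ := (le_max_right _ _).trans_lt hq
  have h2 : 0 < 41 / (δ ^ 2 * ε) := by positivity
  have h3 : 41 / (δ ^ 2 * ε) < ‖φ.slice x‖ ^ 2 := by nlinarith
  rw [div_lt_iff₀ (by positivity)] at h3
  rw [div_lt_iff₀ (by positivity)]
  nlinarith

end Quotient

end HKQuot

theorem mainTheorem5 (d : ℕ) (G : Subgroup (HKQuot.Sp d)) (hG : IsClosed (G : Set (HKQuot.Sp d)))
    (hlf : HKQuot.ActsLocallyFreelyOn G (HKQuot.levelSet G hG 0 \ {0}))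
    (c : Fin 3 → HKQuot.HMat d) (hc : ∀ l, HKQuot.IsCentral G hG (c l))
    (hfree : HKQuot.ActsFreelyOn G (HKQuot.levelSet G hG c)) :
    (∀ p : HKQuot.QuotSpace G hG c, ∃ φ : HKQuot.Chart G hG c, ∃ x : φ.source, φ.point x = p) ∧
      HKQuot.AsymptoticallyNullCurvature G hG c :=
  ⟨HKQuot.exists_chart hfree, HKQuot.asymptoticallyNullCurvature hlf hfree⟩
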